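/- Let $\mathcal X=C(\mathbb R,\mathbb R^3)$ with the topology of uniform convergence on compact sets, and let $\mathcal Y$ be the space of continuous $\mathbb R^3$-valued functions $\omega(s,t)$, $-\infty<s\le t<\infty$, with $\omega(s,t)+\omega(t,u)=\omega(s,u)$ for $s\le t\le u$, with the $\sigma$-algebra generated by the increments $\omega(s,t)$; write $\omega(t)-\omega(s)$ for $\omega(s,t)$. Let $\Phi:\mathcal X\to\mathcal Y$, $(\Phi\omega)(s,t)=\omega(t)-\omega(s)$. Let $\mathcal M_{\mathrm s}$ be the set of probability measures on $\mathcal X$ that are invariant under all time shifts $(\tau_v\omega)(t)=\omega(t+v)$, $v\in\mathbb R$ (laws of stationary processes), let $\mathcal M_{\mathrm{si}}$ be the set of probability measures on $\mathcal Y$ that are invariant under all shifts $(\tau_v\omega)(s,t)=\omega(s+v,t+v)$, $v\in\mathbb R$ (laws of processes with stationary increments), and let $\mathcal M_{\mathrm{si,e}}$ be the set of extreme points of $\mathcal M_{\mathrm{si}}$ (the ergodic laws). Let $\mathbb P\in\mathcal M_{\mathrm{si}}$ be the law of the increments of standard three-dimensional Brownian motion on $\mathbb R$. For an interval $I$ let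 $\mathcal F_I$ be the $\sigma$-algebra generated by the increments $\omega(s)-\omega(r)$ with $r<s$ in $I$, and for $\mathbb Q\in\mathcal M_{\mathrm{si}}$ let $\mathbb Q_{0,\omega}$ be the regular conditional distribution of $\mathbb Q$ given $\mathcal F_{(-\infty,0]}$. Set $$h_{\mathcal F}(\mu|\nu)=\sup_f\Big\{\int f\,d\mu-\log\int e^f\,d\nu\Big\},\qquad H_t(\mathbb Q|\mathbb P)=\mathbb E^{\mathbb Q}\big[h_{\mathcal F_{[0,t]}}(\mathbb Q_{0,\omega}|\mathbb P)\big],\qquad H(\mathbb Q|\mathbb P)=H_1(\mathbb Q|\mathbb P),$$ the supremum being over all bounded continuous $\mathcal F$-measurable functions $f$ on $\mathcal Y$; $H(\mathbb Q|\mathbb P)\in[0,\infty]$ is the specific relative entropy of $\mathbb Q$ with respect to $\mathbb P$. Let $\mathbb Q\in\mathcal M_{\mathrm{si,e}}$ with $H(\mathbb Q|\mathbb P)<\infty$. Then either $$\lim_{\varepsilon\downarrow0}\ \varepsilon\,\mathbb E^{\mathbb Q}\Big[\int_0^\infty \frac{e^{-\varepsilon t}}{|\omega(t)-\omega(0)|}\,dt\Big]=0,$$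 or there is a stationary process $\mathbb Q'\in\mathcal M_{\mathrm s}$ whose increments have the distribution $\mathbb Q$, that is, $\mathbb Q'\circ\Phi^{-1}=\mathbb Q$. -/

import Mathlib

open MeasureTheory ProbabilityTheory Filter Topology
open scoped ENNReal BoundedContinuousFunction

noncomputable section

namespace IncrementProcess

/-- The space `C(ℝ, ℝ^d)` of continuous paths, with the topology of uniform convergence on compact
sets (the compact-open topology). -/
abbrev PathSpace (d : ℕ) : Type := C(ℝ, EuclideanSpace ℝ (Fin d))

/-- The space of continuous increment functions `ω(s, t)` with `ω(s, t) + ω(t, u) = ω(s, u)`.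
An increment function given only for `s ≤ t` has a unique extension of this kind to all pairs,
namely the one with `ω(t, s) = -ω(s, t)`. -/
abbrev IncrementSpace (d : ℕ) : Type :=
  {ω : C(ℝ × ℝ, EuclideanSpace ℝ (Fin d)) // ∀ s t u, ω (s, t) + ω (t, u) = ω (s, u)}

/-- The increment `ω(s, t)`. -/
def incr {d : ℕ} (s t : ℝ) (ω : IncrementSpace d) : EuclideanSpace ℝ (Fin d) := ω.1 (s, t)

/-- The path space carries the σ-algebra generated by the evaluations (this is the Borel
σ-algebra, see below). -/
instance (d : ℕ) : MeasurableSpace (PathSpace d) :=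
  MeasurableSpace.comap (fun (ω : PathSpace d) (t : ℝ) => ω t) MeasurableSpace.pi

/-- The increment space carries the σ-algebra generated by the increments (this is the Borel
σ-algebra, see below). -/
instance (d : ℕ) : MeasurableSpace (IncrementSpace d) :=
  MeasurableSpace.comap (fun (ω : IncrementSpace d) (p : ℝ × ℝ) => incr p.1 p.2 ω)
    MeasurableSpace.pi

theorem polishSpace_continuousMap (X E : Type*) [TopologicalSpace X] [LocallyCompactSpace X]
    [SecondCountableTopology X] [T2Space X] [NormedAddCommGroup E] [CompleteSpace E]
    [SecondCountableTopology E] : PolishSpace C(X, E) := by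
  have h1 : (uniformity C(X, E)).IsCountablyGenerated := inferInstance
  have h2 : CompleteSpace C(X, E) := inferInstance
  have h3 : SecondCountableTopology C(X, E) := inferInstance
  have h4 : T0Space C(X, E) := inferInstance
  exact inferInstance

instance (d : ℕ) : PolishSpace (PathSpace d) := polishSpace_continuousMap _ _

instance (d : ℕ) : PolishSpace (IncrementSpace d) := by
  have := polishSpace_continuousMap (ℝ × ℝ) (EuclideanSpace ℝ (Fin d))
  refine IsClosed.polishSpace
    (s := {ω : C(ℝ × ℝ, EuclideanSpace ℝ (Fin d)) | ∀ s t u, ω (s, t) + ω (t, u) = ω (s, u)}) ?_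
  simp only [Set.ofPred_forall]
  refine isClosed_iInter fun s => isClosed_iInter fun t => isClosed_iInter fun u => ?_
  exact isClosed_eq (by fun_prop) (by fun_prop)

/-- On a Polish space, the σ-algebra generated by a family of continuous evaluations is the Borel
σ-algebra as soon as a countable subfamily separates points. -/
theorem comap_eval_eq_borel {Z ι E : Type*} [TopologicalSpace Z] [PolishSpace Z]
    [TopologicalSpace E] [PolishSpace E] [MeasurableSpace E] [BorelSpace E] (e : Z → ι → E)
    (he : ∀ i, Continuous fun z => e z i) {κ : Type*} [Countable κ] (q : κ → ι)
    (hq : Function.Injective fun z k => e z (q k)) :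
    MeasurableSpace.comap e MeasurableSpace.pi = borel Z := by
  apply le_antisymm
  · let : MeasurableSpace Z := borel Z
    have : BorelSpace Z := ⟨rfl⟩
    exact (measurable_pi_lambda _ fun i => (he i).measurable).comap_le
  · have hm : @MeasurableEmbedding Z (κ → E) (borel Z) _ (fun z k => e z (q k)) := by
      let : MeasurableSpace Z := borel Z
      have : BorelSpace Z := ⟨rfl⟩
      exact (continuous_pi fun k => he (q k)).measurableEmbedding hq
    rw [← @MeasurableEmbedding.comap_eq Z (κ → E) (borel Z) _ _ hm]
    have : (fun z k => e z (q k)) = (fun (x : ι → E) k => x (q k)) ∘ e := rfl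
    rw [this, ← MeasurableSpace.comap_comp]
    exact MeasurableSpace.comap_mono
      (measurable_pi_lambda _ fun k => measurable_pi_apply (q k)).comap_le

instance (d : ℕ) : BorelSpace (PathSpace d) := by
  refine ⟨comap_eval_eq_borel _ (fun t => by fun_prop) (fun r : ℚ => (r : ℝ)) ?_⟩
  intro ω ω' h
  refine DFunLike.coe_injective (Rat.denseRange_cast.equalizer ω.continuous ω'.continuous ?_)
  exact h

instance (d : ℕ) : BorelSpace (IncrementSpace d) := by
  refine ⟨comap_eval_eq_borel _ (fun p => ?_) (fun r : ℚ × ℚ => ((r.1 : ℝ), (r.2 : ℝ))) ?_⟩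
  · unfold incr
    fun_prop
  · intro ω ω' h
    refine Subtype.ext (DFunLike.coe_injective ((Rat.denseRange_cast.prodMap
      Rat.denseRange_cast).equalizer ω.1.continuous ω'.1.continuous ?_))
    exact h

/-- The time shift `(τ_v ω)(t) = ω(t + v)` on paths. -/
def pathShift {d : ℕ} (v : ℝ) (ω : PathSpace d) : PathSpace d :=
  ⟨fun t => ω (t + v), by fun_prop⟩

/-- The time shift `(τ_v ω)(s, t) = ω(s + v, t + v)` on increments. -/
def incrShift {d : ℕ} (v : ℝ) (ω : IncrementSpace d) : IncrementSpace d :=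
  ⟨⟨fun p => ω.1 (p.1 + v, p.2 + v), by fun_prop⟩, fun s t u => ω.2 (s + v) (t + v) (u + v)⟩

/-- The map that sends a path to its increments, `(Φ ω)(s, t) = ω(t) - ω(s)`. -/
def incrementMap {d : ℕ} (ω : PathSpace d) : IncrementSpace d :=
  ⟨⟨fun p => ω p.2 - ω p.1, by fun_prop⟩, fun s t u => by simp⟩

/-- The laws of stationary continuous processes with values in `ℝ^d`. -/
def stationaryLaws (d : ℕ) : Set (Measure (PathSpace d)) :=
  {Q | IsProbabilityMeasure Q ∧ ∀ v : ℝ, MeasurePreserving (pathShift v) Q Q}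

/-- The laws of continuous processes with stationary increments in `ℝ^d`. -/
def stationaryIncrementLaws (d : ℕ) : Set (Measure (IncrementSpace d)) :=
  {Q | IsProbabilityMeasure Q ∧ ∀ v : ℝ, MeasurePreserving (incrShift v) Q Q}

/-- The ergodic laws with stationary increments: the extreme points of the convex set of all
laws with stationary increments. -/
def ergodicIncrementLaws (d : ℕ) : Set (Measure (IncrementSpace d)) :=
  Set.extremePoints ℝ≥0∞ (stationaryIncrementLaws d)

/-- `P` is the law of the increments of standard `d`-dimensional Brownian motion indexed by `ℝ`:
increments over successive intervals are independent, and the increment over `[s, t]` has the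
centred normal law with covariance matrix `(t - s) I`. -/
structure IsBrownianIncrementLaw {d : ℕ} (P : Measure (IncrementSpace d)) : Prop where
  indep : HasIndepIncrements (fun t ω => incr 0 t ω) P
  law : ∀ s t : ℝ, s ≤ t →
    HasLaw (incr s t) (multivariateGaussian 0 ((t - s) • (1 : Matrix (Fin d) (Fin d) ℝ))) P

/-- The σ-algebra generated by the increments `ω(r, s)` with `r < s` in the set `S` of times. -/
@[reducible]
def incrSigma {d : ℕ} (S : Set ℝ) : MeasurableSpace (IncrementSpace d) :=
  ⨆ (r ∈ S) (s ∈ S) (_ : r < s), MeasurableSpace.comap (incr r s) inferInstance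

/-- The relative entropy `sup_f (∫ f dμ - log ∫ e^f dν)` of `μ` with respect to `ν` on the
σ-algebra `F` generated by the increments with times in `S`, where `f` runs over the bounded
continuous `F`-measurable functions. The choice `f = 0` shows that cutting the terms off at `0`
does not change the supremum for probability measures. -/
def relEntropyOn {d : ℕ} (S : Set ℝ) (μ ν : Measure (IncrementSpace d)) : ℝ≥0∞ :=
  ⨆ (f : IncrementSpace d →ᵇ ℝ) (_ : Measurable[incrSigma S] f),
    ENNReal.ofReal (∫ ω, f ω ∂μ - Real.log (∫ ω, Real.exp (f ω) ∂ν))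

/-- The entropy `H_t(Q | P)`: the `Q`-mean of the relative entropy on the σ-algebra of the
increments in `[0, t]` of the regular conditional law of `Q`, given the increments in `(-∞, 0]`,
with respect to `P`. -/
def entropyUpTo {d : ℕ} (t : ℝ) (Q : Measure (IncrementSpace d)) [IsFiniteMeasure Q]
    (P : Measure (IncrementSpace d)) : ℝ≥0∞ :=
  ∫⁻ ω, relEntropyOn (Set.Icc 0 t) (condExpKernel Q (incrSigma (Set.Iic 0)) ω) P ∂Q

/-- The specific relative entropy `H(Q | P)`, that is, entropy per unit of time: for a law `Q`
with stationary increments, `H_t(Q | P) = t H(Q | P)` for all `t > 0`. -/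
def specificEntropy {d : ℕ} (Q : Measure (IncrementSpace d)) [IsFiniteMeasure Q]
    (P : Measure (IncrementSpace d)) : ℝ≥0∞ :=
  entropyUpTo 1 Q P

/-- The expectation under `Q` of `∫_0^∞ e^{-εt} / |ω(t) - ω(0)| dt`, as an element of `[0, ∞]`
(with `1 / 0 = ∞`). -/
def coulombIntegral {d : ℕ} (Q : Measure (IncrementSpace d)) (ε : ℝ) : ℝ≥0∞ :=
  ∫⁻ ω, (∫⁻ t in Set.Ioi (0 : ℝ), ENNReal.ofReal (Real.exp (-ε * t)) * ‖incr 0 t ω‖ₑ⁻¹) ∂Q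

end IncrementProcess

end

namespace IncrementProcess

/-! Let a path start from a Lebesgue-distributed point, independently of increments with law `Q`.
The resulting infinite measure `pathMeasure Q` on paths is shift-invariant, and the shifts act on
its `L²` space by isometries. Two cases arise.

If some nonzero `ψ` in `L²` is invariant, then `ψ²` is the density of a finite shift-invariant
measure on paths. Its image under `incrementMap` is invariant and absolutely continuous with respect
to `Q`, hence a multiple of `Q` by ergodicity. Normalising gives a stationary process with increment
law `Q` (`exists_stationary_of_invariant`).

If there is no such `ψ`, the weak Abel ergodic theorem (`tendsto_abel_mean_inner`), applied to the
indicator of the paths that are in a ball at time 0, sends the Abel means of its correlations to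
zero. These dominate the return probabilities `Q(|ω(t) - ω(0)| ≤ R)` up to a constant, so the Abel
means of the latter vanish for every `R` (`tendsto_returnMean_of_not_stationary`).

Passing from return probabilities to `1/|x|` requires control of the singularity, and this is where
entropy enters. Up to a smoothing of the potentials, `1/|x| ≤ 1/R + η⁻¹ 1{|x| ≤ R} + √η |x|^{-3/2}`,
and the mean of `|ω(t) - ω(0)|^{-3/2}` over each unit time interval is at most `1000 (H(Q|P) + log
2)` (`lintegral_softPotential_le`). That bound is the entropy inequality conditional on the past,
combined with Khasminskii's lemma for Brownian motion: `|x|^{-3/2}` has Gaussian mean of order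
`v^{-3/4}` uniformly in the centre, which is integrable in time near 0. -/

/-! ### Gaussian means of the potential `|x|^{-3/2}` -/

theorem integral_indicator_inv_sqrt_abs_le {δ ρ : ℝ} (hδ : 0 < δ) (hρ : 0 < ρ) :
    ∫ u : ℝ, (Set.Iic ρ).indicator (fun v => (√(v + δ))⁻¹) |u| ≤ 4 * √ρ := by
  rw [integral_comp_abs (f := (Set.Iic ρ).indicator (fun v => (√(v + δ))⁻¹)),
    setIntegral_indicator measurableSet_Iic]
  have h1 : Set.Ioi (0 : ℝ) ∩ Set.Iic ρ = Set.Ioc 0 ρ := rfl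
  rw [h1, ← intervalIntegral.integral_of_le hρ.le]
  have h2 : ∀ x ∈ Set.uIcc 0 ρ, HasDerivAt (fun v => 2 * √(v + δ)) ((√(x + δ))⁻¹) x := by
    intro x hx
    rw [Set.uIcc_of_le hρ.le] at hx
    have hpos : 0 < x + δ := by linarith [hx.1]
    have := (((hasDerivAt_id x).add_const δ).sqrt hpos.ne').const_mul 2
    refine this.congr_deriv ?_
    simp only [id]
    field_simp
  rw [intervalIntegral.integral_eq_sub_of_hasDerivAt h2]
  -- Subadditivity of the square root makes the bound independent of `δ`.
  · have : √(ρ + δ) ≤ √ρ + √δ := by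
      rw [Real.sqrt_le_left (by positivity)]
      nlinarith [Real.sq_sqrt hρ.le, Real.sq_sqrt hδ.le, Real.sqrt_nonneg ρ, Real.sqrt_nonneg δ,
        mul_nonneg (Real.sqrt_nonneg ρ) (Real.sqrt_nonneg δ)]
    simp only [zero_add]
    linarith
  · refine ContinuousOn.intervalIntegrable fun x hx => ContinuousAt.continuousWithinAt ?_
    rw [Set.uIcc_of_le hρ.le] at hx
    have hpos : 0 < x + δ := by linarith [hx.1]
    exact ContinuousAt.inv₀ (by fun_prop) (Real.sqrt_ne_zero'.2 hpos)

theorem gaussianPDFReal_le_inv_sqrt (m : ℝ) {v : NNReal} (hv : 0 < v) (x : ℝ) :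
    gaussianPDFReal m v x ≤ (√v)⁻¹ := by
  have hv' : (0 : ℝ) < v := hv
  rw [gaussianPDFReal]
  have h1 : Real.exp (-(x - m) ^ 2 / (2 * v)) ≤ 1 := by
    rw [Real.exp_le_one_iff]
    have : 0 ≤ (x - m) ^ 2 / (2 * v) := by positivity
    rw [neg_div]
    linarith
  have h2 : (√(2 * Real.pi * v))⁻¹ ≤ (√v)⁻¹ := by
    gcongr
    nlinarith [Real.pi_gt_three]
  calc _ ≤ (√v)⁻¹ * 1 := by gcongr
    _ = _ := mul_one _

/-- The mean of `|y + X|^{-1/2}` for a centred normal `X` of variance `v` is at most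
`5 v^{-1/4}`, uniformly in `y`. -/
theorem integral_gaussianReal_inv_sqrt_le {δ : ℝ} (hδ : 0 < δ) {v : NNReal} (hv : 0 < v) (y : ℝ) :
    ∫ x, (√(|y + x| + δ))⁻¹ ∂(gaussianReal 0 v) ≤ 5 * (√√(v : ℝ))⁻¹ := by
  have hv' : (0 : ℝ) < √v := Real.sqrt_pos.2 hv
  rw [integral_gaussianReal_eq_integral_smul hv.ne']
  have hcont : Continuous fun u : ℝ => (√(|u| + δ))⁻¹ :=
    Continuous.inv₀ (by fun_prop) fun u => Real.sqrt_ne_zero'.2 (by positivity)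
  have hbd : ∀ u : ℝ, (√(|u| + δ))⁻¹ ≤ (√δ)⁻¹ := fun u => by
    gcongr
    linarith [abs_nonneg u]
  -- Split at one standard deviation `√v`: beyond it the integrand is at most `v^{-1/4}`; within it
  -- the density is at most `v^{-1/2}` and the potential integrates to at most `4 v^{1/4}`.
  set φ : ℝ → ℝ := fun u => (Set.Iic √v).indicator (fun w => (√(w + δ))⁻¹) |u| with hφ
  have hφeq : φ = (Set.Icc (-√v) √v).indicator fun u => (√(|u| + δ))⁻¹ := by
    ext u
    simp only [hφ, Set.indicator, Set.mem_Iic, Set.mem_Icc, abs_le]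
  have hφint : Integrable φ := by
    rw [hφeq, integrable_indicator_iff measurableSet_Icc]
    exact hcont.continuousOn.integrableOn_compact isCompact_Icc
  have hpt : ∀ x, gaussianPDFReal 0 v x • (√(|y + x| + δ))⁻¹ ≤
      gaussianPDFReal 0 v x * (√√(v : ℝ))⁻¹ + (√v)⁻¹ * φ (y + x) := by
    intro x
    have h0 := gaussianPDFReal_nonneg 0 v x
    have h1 := gaussianPDFReal_le_inv_sqrt 0 hv x
    rw [smul_eq_mul]
    by_cases hx : |y + x| ≤ √v
    · have : φ (y + x) = (√(|y + x| + δ))⁻¹ := by simp [hφ, hx]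
      rw [this]
      have h2 : 0 ≤ gaussianPDFReal 0 v x * (√√(v : ℝ))⁻¹ := by positivity
      have h3 : gaussianPDFReal 0 v x * (√(|y + x| + δ))⁻¹ ≤ (√v)⁻¹ * (√(|y + x| + δ))⁻¹ := by
        gcongr
      linarith
    · have : φ (y + x) = 0 := by simp [hφ, hx]
      rw [this, mul_zero, add_zero]
      push Not at hx
      gcongr
      linarith
  have hi1 : Integrable fun x => gaussianPDFReal 0 v x * (√√(v : ℝ))⁻¹ :=
    (integrable_gaussianPDFReal 0 v).mul_const _
  have hi2 : Integrable fun x => (√v)⁻¹ * φ (y + x) := (hφint.comp_add_left y).const_mul _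
  have hi3 : Integrable fun x => gaussianPDFReal 0 v x • (√(|y + x| + δ))⁻¹ := by
    refine (integrable_gaussianPDFReal 0 v).mul_bdd (c := (√δ)⁻¹)
      (hcont.comp (continuous_const_add y)).aestronglyMeasurable (ae_of_all _ fun x => ?_)
    rw [Real.norm_of_nonneg (by positivity)]
    exact hbd _
  calc _ ≤ ∫ x, (gaussianPDFReal 0 v x * (√√(v : ℝ))⁻¹ + (√v)⁻¹ * φ (y + x)) :=
        integral_mono hi3 (hi1.add hi2) hpt
    _ = (√√(v : ℝ))⁻¹ + (√v)⁻¹ * ∫ u, φ u := by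
        rw [integral_add hi1 hi2, integral_mul_const, integral_gaussianPDFReal_eq_one 0 hv.ne',
          integral_const_mul, integral_add_left_eq_self φ y, one_mul]
    _ ≤ (√√(v : ℝ))⁻¹ + (√v)⁻¹ * (4 * √√(v : ℝ)) := by
        gcongr
        exact integral_indicator_inv_sqrt_abs_le hδ hv'
    _ = 5 * (√√(v : ℝ))⁻¹ := by
        have h4 : √(v : ℝ) = √√(v : ℝ) * √√(v : ℝ) := (Real.mul_self_sqrt hv'.le).symm
        have h5 : 0 < √√(v : ℝ) := Real.sqrt_pos.2 hv'
        have h6 : (√(v : ℝ))⁻¹ = (√√(v : ℝ))⁻¹ * (√√(v : ℝ))⁻¹ := by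
          rw [← mul_inv, ← h4]
        rw [h6]
        field_simp
        norm_num

theorem multivariateGaussian_smul_one {d : ℕ} (v : NNReal) :
    multivariateGaussian 0 ((v : ℝ) • (1 : Matrix (Fin d) (Fin d) ℝ)) =
      (Measure.pi fun _ : Fin d => gaussianReal 0 v).map (WithLp.toLp 2) := by
  have hS : ((v : ℝ) • (1 : Matrix (Fin d) (Fin d) ℝ)).PosSemidef :=
    Matrix.PosSemidef.one.smul v.2
  refine Measure.ext_of_charFun (E := EuclideanSpace ℝ (Fin d)) ?_
  ext t
  rw [charFun_multivariateGaussian hS, charFun_pi]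
  simp only [charFun_gaussianReal, ← Complex.exp_sum]
  congr 1
  simp [Matrix.smul_mulVec, dotProduct, Finset.sum_div]
  exact Finset.sum_congr rfl fun i _ => by ring

/-- A continuous bounded approximation of `|x|^{-3/2}`. -/
noncomputable def softPotential {d : ℕ} (δ : ℝ) (x : EuclideanSpace ℝ (Fin d)) : ℝ :=
  ((‖x‖ + δ) * √(‖x‖ + δ))⁻¹

theorem softPotential_nonneg {d : ℕ} {δ : ℝ} (hδ : 0 < δ) (x : EuclideanSpace ℝ (Fin d)) :
    0 ≤ softPotential δ x := by
  unfold softPotential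
  positivity

theorem softPotential_le {d : ℕ} {δ : ℝ} (hδ : 0 < δ) (x : EuclideanSpace ℝ (Fin d)) :
    softPotential δ x ≤ (δ * √δ)⁻¹ := by
  unfold softPotential
  have : δ ≤ ‖x‖ + δ := by linarith [norm_nonneg x]
  gcongr

theorem continuous_softPotential {d : ℕ} {δ : ℝ} (hδ : 0 < δ) :
    Continuous (softPotential δ : EuclideanSpace ℝ (Fin d) → ℝ) := by
  unfold softPotential
  exact Continuous.inv₀ (by fun_prop) fun x => by positivity

/-- Each coordinate is bounded by the norm. In dimension three the exponent `3/2` splits evenly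
among the coordinates, so that Gaussian means factorise into one-dimensional ones. -/
theorem softPotential_le_prod {δ : ℝ} (hδ : 0 < δ) (x : EuclideanSpace ℝ (Fin 3)) :
    softPotential δ x ≤ ∏ i, (√(|x i| + δ))⁻¹ := by
  unfold softPotential
  have h : ∀ i, √(|x i| + δ) ≤ √(‖x‖ + δ) := fun i => by
    gcongr
    exact PiLp.norm_apply_le x i
  have hp : ∀ i, 0 < √(|x i| + δ) := fun i => by positivity
  rw [Finset.prod_inv_distrib]
  refine inv_anti₀ (Finset.prod_pos fun i _ => hp i) ?_
  · calc ∏ i, √(|x i| + δ) ≤ ∏ _i : Fin 3, √(‖x‖ + δ) :=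
          Finset.prod_le_prod (fun i _ => (hp i).le) fun i _ => h i
      _ = √(‖x‖ + δ) * √(‖x‖ + δ) * √(‖x‖ + δ) := by
          simp [pow_succ]
      _ = _ := by rw [Real.mul_self_sqrt (by positivity)]

theorem integral_softPotential_gaussian_le {δ : ℝ} (hδ : 0 < δ) {v : NNReal} (hv : 0 < v)
    (y : EuclideanSpace ℝ (Fin 3)) :
    ∫ x, softPotential δ (y + x)
      ∂(multivariateGaussian 0 ((v : ℝ) • (1 : Matrix (Fin 3) (Fin 3) ℝ))) ≤
      125 * ((√√(v : ℝ))⁻¹) ^ 3 := by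
  have hcont : Continuous fun u : ℝ => (√(|u| + δ))⁻¹ :=
    Continuous.inv₀ (by fun_prop) fun u => Real.sqrt_ne_zero'.2 (by positivity)
  have hbd : ∀ u : ℝ, ‖(√(|u| + δ))⁻¹‖ ≤ (√δ)⁻¹ := fun u => by
    rw [Real.norm_of_nonneg (by positivity)]
    gcongr
    linarith [abs_nonneg u]
  have hcp := continuous_softPotential (d := 3) hδ
  have hcy : Continuous fun x => softPotential δ (y + x) := hcp.comp (continuous_const_add y)
  rw [multivariateGaussian_smul_one, integral_map (by fun_prop) hcy.aestronglyMeasurable]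
  calc _ ≤ ∫ x : Fin 3 → ℝ, ∏ i, (√(|y i + x i| + δ))⁻¹
        ∂(Measure.pi fun _ : Fin 3 => gaussianReal 0 v) := by
        refine integral_mono_of_nonneg (ae_of_all _ fun x => softPotential_nonneg hδ _) ?_
          (ae_of_all _ fun x => ?_)
        · refine Integrable.fintype_prod (f := fun i u => (√(|y i + u| + δ))⁻¹) fun i => ?_
          exact Integrable.of_bound (hcont.comp (continuous_const_add (y i))).aestronglyMeasurable
            ((√δ)⁻¹) (ae_of_all _ fun u => hbd _)
        · exact softPotential_le_prod hδ _
    _ = ∏ i, ∫ u, (√(|y i + u| + δ))⁻¹ ∂(gaussianReal 0 v) :=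
        integral_fintype_prod_eq_prod (fun i u => (√(|y i + u| + δ))⁻¹)
    _ ≤ ∏ _i : Fin 3, 5 * (√√(v : ℝ))⁻¹ :=
        Finset.prod_le_prod (fun i _ => integral_nonneg fun u => by positivity)
          fun i _ => integral_gaussianReal_inv_sqrt_le hδ hv (y i)
    _ = _ := by
        rw [Finset.prod_const, Finset.card_univ, Fintype.card_fin, mul_pow]
        norm_num

/-! ### Increments and changes of time -/

section Increments

variable {d : ℕ}

theorem incr_add (s t u : ℝ) (ω : IncrementSpace d) : incr s t ω + incr t u ω = incr s u ω :=
  ω.2 s t u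

theorem incr_self (s : ℝ) (ω : IncrementSpace d) : incr s s ω = 0 := by
  simpa using incr_add s s s ω

theorem incr_sub (r s t : ℝ) (ω : IncrementSpace d) : incr r t ω - incr r s ω = incr s t ω := by
  rw [← incr_add r s t ω]
  abel

theorem continuous_incr (s t : ℝ) : Continuous (incr s t : IncrementSpace d → _) := by
  unfold incr
  fun_prop

theorem measurable_incr (s t : ℝ) : Measurable (incr s t : IncrementSpace d → _) :=
  (continuous_incr s t).measurable

theorem continuous_incr_uncurry :
    Continuous fun p : IncrementSpace d × (ℝ × ℝ) => incr p.2.1 p.2.2 p.1 := by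
  unfold incr
  fun_prop

theorem Continuous.incr {Z : Type*} [TopologicalSpace Z] {f g : Z → ℝ} {h : Z → IncrementSpace d}
    (hf : Continuous f) (hg : Continuous g) (hh : Continuous h) :
    Continuous fun z => IncrementProcess.incr (f z) (g z) (h z) :=
  continuous_incr_uncurry.comp (hh.prodMk (hf.prodMk hg))

/-- The change of time `(s, t) ↦ ω(c s, c t)` in an increment function. -/
def changeTime (c : C(ℝ, ℝ)) (ω : IncrementSpace d) : IncrementSpace d :=
  ⟨⟨fun p => ω.1 (c p.1, c p.2), by fun_prop⟩, fun s t u => ω.2 (c s) (c t) (c u)⟩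

theorem incr_changeTime (c : C(ℝ, ℝ)) (s t : ℝ) (ω : IncrementSpace d) :
    incr s t (changeTime c ω) = incr (c s) (c t) ω := rfl

theorem measurable_of_measurable_incr {Ω : Type*} {m : MeasurableSpace Ω} {f : Ω → IncrementSpace d}
    (hf : ∀ s t, Measurable fun x => incr s t (f x)) : Measurable f := by
  rw [measurable_comap_iff]
  exact measurable_pi_lambda _ fun p => hf p.1 p.2

theorem measurable_changeTime (c : C(ℝ, ℝ)) : Measurable (changeTime c : IncrementSpace d → _) :=
  measurable_of_measurable_incr fun s t => measurable_incr (c s) (c t)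

end Increments

/-! ### Independence of an increment from the future -/

section Independence

variable {d : ℕ} {P : Measure (IncrementSpace d)}

theorem IsBrownianIncrementLaw.isProbabilityMeasure (hP : IsBrownianIncrementLaw P) :
    IsProbabilityMeasure P := by
  have h := (hP.law 0 0 le_rfl)
  have : IsProbabilityMeasure (P.map (incr 0 0)) := by
    rw [h.map_eq]
    infer_instance
  exact Measure.isProbabilityMeasure_of_map (incr 0 0)

/-- Independence of increments is used along monotone sequences of times; this one makes `[s, r]`
the first interval and visits any prescribed finite set of later times. -/
theorem exists_monotone_seq (s r : ℝ) (hsr : s ≤ r) (J : Finset ℝ) (hJ : ∀ x ∈ J, r ≤ x) :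
    ∃ t : ℕ → ℝ, Monotone t ∧ t 0 = s ∧ t 1 = r ∧ ∀ x ∈ J, ∃ n, t (n + 1) = x := by
  classical
  obtain ⟨n, hn⟩ : ∃ n, (insert r J).card = n + 1 :=
    Nat.exists_eq_add_one.2 (Finset.card_pos.2 (Finset.insert_nonempty r J))
  set e := (insert r J).orderEmbOfFin hn with he
  have hmem : ∀ i, r ≤ e i := fun i => by
    have := (insert r J).orderEmbOfFin_mem hn i
    rcases Finset.mem_insert.1 this with h | h
    · exact h.ge
    · exact hJ _ h
  have hex : ∀ x ∈ insert r J, ∃ i, e i = x := fun x hx => by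
    have := (insert r J).range_orderEmbOfFin hn
    have hx' : x ∈ Set.range e := by rw [this]; exact_mod_cast hx
    exact hx'
  -- First `s`, then `r` and the points of `J` in increasing order, then the largest of them
  -- forever.
  refine ⟨fun k => Nat.casesOn k s fun k => e ⟨min k n, by omega⟩, ?_, rfl, ?_, ?_⟩
  · refine monotone_nat_of_le_succ fun k => ?_
    cases k with
    | zero => exact hsr.trans (hmem _)
    | succ k => exact e.monotone (by simp only [Fin.mk_le_mk]; omega)
  · obtain ⟨i, hi⟩ := hex r (Finset.mem_insert_self r J)
    refine le_antisymm ?_ (hmem _)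
    rw [← hi]
    exact e.monotone (Fin.zero_le i)
  · intro x hx
    obtain ⟨i, hi⟩ := hex x (Finset.mem_insert_of_mem hx)
    refine ⟨i, ?_⟩
    rw [← hi]
    exact congrArg e (Fin.ext (min_eq_left (Nat.lt_succ_iff.1 i.2)))

/-- The increment over `[s, r]` is independent of all increments after time `r`. -/
theorem IsBrownianIncrementLaw.indepFun_changeTime (hP : IsBrownianIncrementLaw P) {s r : ℝ}
    (hsr : s ≤ r) (c : C(ℝ, ℝ)) (hc : ∀ u, r ≤ c u) :
    IndepFun (incr s r) (changeTime c) P := by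
  classical
  have := hP.isProbabilityMeasure
  suffices h : IndepFun (incr s r) (fun ω (p : ℝ × ℝ) => incr (c p.1) (c p.2) ω) P by
    rw [IndepFun_iff_Indep] at h ⊢
    have hcomap : MeasurableSpace.comap (changeTime c) (inferInstance :
        MeasurableSpace (IncrementSpace d)) =
        MeasurableSpace.comap (fun ω (p : ℝ × ℝ) => incr (c p.1) (c p.2) ω) MeasurableSpace.pi :=
      MeasurableSpace.comap_comp
    rwa [hcomap]
  refine IndepFun.indepFun_process (measurable_incr s r) (fun p => measurable_incr _ _) fun I => ?_
  obtain ⟨t, ht, h0, h1, hJ⟩ := exists_monotone_seq s r hsr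
    (I.image (fun p => c p.1) ∪ I.image (fun p => c p.2)) (by
      intro x hx
      simp only [Finset.mem_union, Finset.mem_image] at hx
      rcases hx with ⟨p, _, rfl⟩ | ⟨p, _, rfl⟩ <;> exact hc _)
  have hi := hP.indep.nat ht
  simp only [incr_sub] at hi
  -- Interval number 0 is `[s, r]`; the intervals with numbers `≥ 1` generate, by telescoping from
  -- `r`, all increments between the chosen later times.
  have hind := indep_iSup_of_disjoint (fun k => (measurable_incr (t k) (t (k + 1))).comap_le)
    hi.iIndep (S := {0}) (T := Set.Ici 1) (by simp)
  rw [IndepFun_iff_Indep]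
  refine indep_of_indep_of_le_left (indep_of_indep_of_le_right hind ?_) ?_
  · have hm : ∀ n, Measurable[⨆ k ∈ Set.Ici 1, MeasurableSpace.comap (incr (t k) (t (k + 1)))
        inferInstance]
        (incr r (t (n + 1)) : IncrementSpace d → _) := by
      intro n
      induction n with
      | zero =>
        have : (incr r (t (0 + 1)) : IncrementSpace d → _) = fun _ => 0 := by
          ext1 ω
          rw [zero_add, h1, incr_self]
        rw [this]
        exact measurable_const
      | succ n ih =>
        have : (incr r (t (n + 1 + 1)) : IncrementSpace d → _) =
            fun ω => incr r (t (n + 1)) ω + incr (t (n + 1)) (t (n + 1 + 1)) ω := by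
          ext1 ω
          rw [incr_add]
        rw [this]
        refine Measurable.add ih ?_
        refine Measurable.mono (comap_measurable _) ?_ le_rfl
        exact le_iSup₂_of_le (n + 1) (by simp) le_rfl
    refine Measurable.comap_le ?_
    refine @measurable_pi_lambda _ _ _ (_) _ _ fun p => ?_
    obtain ⟨n, hn⟩ := hJ (c p.1.1) (Finset.mem_union_left _ (Finset.mem_image_of_mem _ p.2))
    obtain ⟨k, hk⟩ := hJ (c p.1.2) (Finset.mem_union_right _ (Finset.mem_image_of_mem _ p.2))
    have h2 := (hm k).sub (hm n)
    rw [hn, hk] at h2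
    convert h2 using 2 with ω
    exact (incr_sub _ _ _ ω).symm
  · refine le_iSup₂_of_le 0 (Set.mem_singleton 0) ?_
    rw [h0, zero_add, h1]

end Independence

/-! ### Exponential moments of additive functionals of Brownian motion -/

section ExponentialMoment

/-- The integrand on the right is the derivative in `r` of `-exp (∫ q in r..t, w q)`. This form
isolates the potential at the earliest time `r`, so that independence of the increments after `r`
applies. -/
theorem exp_integral_eq_one_add {w : ℝ → ℝ} (hw : Continuous w) (hw0 : ∀ r, 0 ≤ w r) {s t : ℝ}
    (hst : s ≤ t) :
    ENNReal.ofReal (Real.exp (∫ q in s..t, w q)) =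
      1 + ∫⁻ r in Set.Ioc s t, ENNReal.ofReal (w r) * ENNReal.ofReal (Real.exp (∫ q in r..t, w q)) := by
  have hderiv : ∀ r, HasDerivAt (fun r => -Real.exp (∫ q in r..t, w q))
      (w r * Real.exp (∫ q in r..t, w q)) r := fun r => by
    have h1 := intervalIntegral.integral_hasDerivAt_left (hw.intervalIntegrable r t)
      (hw.stronglyMeasurableAtFilter _ _) hw.continuousAt
    refine h1.exp.neg.congr_deriv ?_
    ring
  have hc : Continuous fun r => w r * Real.exp (∫ q in r..t, w q) := by
    refine hw.mul (Real.continuous_exp.comp ?_)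
    simp_rw [intervalIntegral.integral_symm t]
    exact (intervalIntegral.continuous_primitive (fun a b => hw.intervalIntegrable a b) t).neg
  have h2 := intervalIntegral.integral_eq_sub_of_hasDerivAt (fun r _ => hderiv r)
    (hc.intervalIntegrable s t)
  have h0 : ∀ r, 0 ≤ w r * Real.exp (∫ q in r..t, w q) := fun r =>
    mul_nonneg (hw0 r) (Real.exp_pos _).le
  simp_rw [← ENNReal.ofReal_mul (hw0 _)]
  rw [← ofReal_integral_eq_lintegral_ofReal, ← intervalIntegral.integral_of_le hst, h2,
    ← ENNReal.ofReal_one, ← ENNReal.ofReal_add zero_le_one]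
  · simp
  · simp only [intervalIntegral.integral_same, Real.exp_zero, sub_neg_eq_add, neg_add_eq_sub,
      sub_nonneg, Real.one_le_exp_iff]
    exact intervalIntegral.integral_nonneg hst fun r _ => hw0 r
  · exact hc.integrableOn_Ioc
  · exact ae_of_all _ h0

variable {d : ℕ} {P : Measure (IncrementSpace d)} {W : EuclideanSpace ℝ (Fin d) → ℝ}

theorem continuous_integral_potential (hW : Continuous W) (s t : ℝ) :
    Continuous fun p : EuclideanSpace ℝ (Fin d) × IncrementSpace d =>
      ∫ q in s..t, W (p.1 + incr s q p.2) := by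
  refine intervalIntegral.continuous_parametric_intervalIntegral_of_continuous'
    (f := fun (p : EuclideanSpace ℝ (Fin d) × IncrementSpace d) q => W (p.1 + incr s q p.2)) ?_ s t
  refine hW.comp (continuous_fst.fst.add ?_)
  exact Continuous.incr continuous_const continuous_snd continuous_fst.snd

theorem integral_potential_le {k : ℝ} (hW : Continuous W) (hk : ∀ x, W x ≤ k) {s t : ℝ}
    (hst : s ≤ t) (x : EuclideanSpace ℝ (Fin d)) (ω : IncrementSpace d) :
    ∫ q in s..t, W (x + incr s q ω) ≤ (t - s) * k := by
  have hc : Continuous fun q => W (x + incr s q ω) :=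
    hW.comp (continuous_const.add (Continuous.incr continuous_const continuous_id continuous_const))
  have := intervalIntegral.integral_mono_on (μ := volume) hst (hc.intervalIntegrable s t)
    intervalIntegrable_const fun q _ => hk (x + incr s q ω)
  simpa using this

/-- **Khasminskii's lemma** for the increments of Brownian motion. -/
theorem IsBrownianIncrementLaw.lintegral_exp_integral_le_two (hP : IsBrownianIncrementLaw P)
    (hW : Continuous W) (hW0 : ∀ x, 0 ≤ W x) {k : ℝ} (hk : ∀ x, W x ≤ k)
    (hsmall : ∀ s ∈ Set.Icc (0 : ℝ) 1, ∀ x,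
      ∫⁻ r in Set.Ioc s 1, ∫⁻ ω, ENNReal.ofReal (W (x + incr s r ω)) ∂P ≤ 2⁻¹)
    {s : ℝ} (hs : s ∈ Set.Icc (0 : ℝ) 1) (x : EuclideanSpace ℝ (Fin d)) :
    ∫⁻ ω, ENNReal.ofReal (Real.exp (∫ q in s..1, W (x + incr s q ω))) ∂P ≤ 2 := by
  have := hP.isProbabilityMeasure
  have hk0 : 0 ≤ k := (hW0 0).trans (hk 0)
  set u : ℝ → EuclideanSpace ℝ (Fin d) → ℝ≥0∞ := fun s x =>
    ∫⁻ ω, ENNReal.ofReal (Real.exp (∫ q in s..1, W (x + incr s q ω))) ∂P with hu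
  set M : ℝ≥0∞ := ⨆ (s ∈ Set.Icc (0 : ℝ) 1) (x), u s x with hM
  have huM : ∀ s ∈ Set.Icc (0 : ℝ) 1, ∀ x, u s x ≤ M := fun s hs x =>
    (le_iSup (u s) x).trans (le_iSup₂ (f := fun s (_ : s ∈ Set.Icc (0 : ℝ) 1) => ⨆ x, u s x) s hs)
  -- The crude bound `exp k` serves only to make `M` finite, so that `M ≤ 1 + M / 2` can be solved
  -- for `M`.
  have hMtop : M ≠ ⊤ := by
    refine ne_top_of_le_ne_top (ENNReal.ofReal_ne_top (r := Real.exp k)) ?_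
    refine iSup₂_le fun s hs => iSup_le fun x => ?_
    calc u s x ≤ ∫⁻ _, ENNReal.ofReal (Real.exp k) ∂P := by
          refine lintegral_mono fun ω => ?_
          gcongr
          refine (integral_potential_le hW hk hs.2 x ω).trans ?_
          nlinarith [hs.1]
      _ = _ := by simp
  have hstep : ∀ s ∈ Set.Icc (0 : ℝ) 1, ∀ x, u s x ≤ 1 + 2⁻¹ * M := by
    intro s hs x
    have hjoint : Continuous fun p : IncrementSpace d × ℝ =>
        ENNReal.ofReal (W (x + incr s p.2 p.1)) *
          ENNReal.ofReal (Real.exp (∫ q in p.2..1, W (x + incr s q p.1))) := by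
      simp_rw [← ENNReal.ofReal_mul (hW0 _)]
      refine ENNReal.continuous_ofReal.comp (Continuous.mul ?_ (Real.continuous_exp.comp ?_))
      · exact hW.comp (continuous_const.add
          (Continuous.incr continuous_const continuous_snd continuous_fst))
      · simp_rw [intervalIntegral.integral_symm 1]
        refine (intervalIntegral.continuous_parametric_intervalIntegral_of_continuous
          (f := fun (p : IncrementSpace d × ℝ) q => W (x + incr s q p.1)) ?_ continuous_snd).neg
        exact hW.comp (continuous_const.add
          (Continuous.incr continuous_const continuous_snd continuous_fst.fst))
    calc u s x = ∫⁻ ω, (1 + ∫⁻ r in Set.Ioc s 1, ENNReal.ofReal (W (x + incr s r ω)) *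
            ENNReal.ofReal (Real.exp (∫ q in r..1, W (x + incr s q ω)))) ∂P := by
          refine lintegral_congr fun ω => ?_
          exact exp_integral_eq_one_add (w := fun q => W (x + incr s q ω))
            (hW.comp (continuous_const.add
              (Continuous.incr continuous_const continuous_id continuous_const)))
            (fun r => hW0 _) hs.2
      _ = 1 + ∫⁻ r in Set.Ioc s 1, ∫⁻ ω, ENNReal.ofReal (W (x + incr s r ω)) *
            ENNReal.ofReal (Real.exp (∫ q in r..1, W (x + incr s q ω))) ∂P := by
          rw [lintegral_add_left measurable_const, lintegral_const, measure_univ, mul_one,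
            lintegral_lintegral_swap hjoint.measurable.aemeasurable]
      _ ≤ 1 + ∫⁻ r in Set.Ioc s 1, (∫⁻ ω, ENNReal.ofReal (W (x + incr s r ω)) ∂P) * M := by
          gcongr 1 + ?_
          refine setLIntegral_mono' measurableSet_Ioc fun r hr => ?_
          have hr' : r ∈ Set.Icc (0 : ℝ) 1 := ⟨hs.1.trans hr.1.le, hr.2⟩
          -- `changeTime c ω` involves only increments after `r`, hence is independent of `incr s r
          -- ω`, and it agrees with `ω` on `[r, 1]`.
          set c : C(ℝ, ℝ) := ⟨fun u => max r u, by fun_prop⟩ with hc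
          have hind := hP.indepFun_changeTime hr.1.le c fun u => le_max_left r u
          set F : EuclideanSpace ℝ (Fin d) × IncrementSpace d → ℝ≥0∞ := fun p =>
            ENNReal.ofReal (W (x + p.1)) *
              ENNReal.ofReal (Real.exp (∫ q in r..1, W (x + p.1 + incr r q p.2))) with hF
          have hFm : Measurable F := by
            refine Measurable.mul
              (f := fun p : EuclideanSpace ℝ (Fin d) × IncrementSpace d => ENNReal.ofReal (W (x + p.1))) ?_ ?_
            · exact (hW.comp (continuous_const.add continuous_fst)).measurable.ennreal_ofReal
            · refine Measurable.ennreal_ofReal (Continuous.measurable (Real.continuous_exp.comp ?_))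
              exact (continuous_integral_potential hW r 1).comp
                ((continuous_const.add continuous_fst).prodMk continuous_snd)
          have hct : ∀ (y : EuclideanSpace ℝ (Fin d)) (ω : IncrementSpace d),
              ∫ q in r..1, W (y + incr r q (changeTime c ω)) = ∫ q in r..1, W (y + incr r q ω) := by
            intro y ω
            refine intervalIntegral.integral_congr fun q hq => ?_
            rw [Set.uIcc_of_le hr.2] at hq
            simp only [incr_changeTime, hc, ContinuousMap.coe_mk, max_self, max_eq_right hq.1]
          have hmap := (indepFun_iff_map_prod_eq_prod_map_map
            (measurable_incr s r).aemeasurable (measurable_changeTime c).aemeasurable).1 hind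
          calc _ = ∫⁻ ω, F (incr s r ω, changeTime c ω) ∂P := by
                refine lintegral_congr fun ω => ?_
                simp only [hF, hct]
                simp only [add_assoc, incr_add]
            _ = ∫⁻ p, F p ∂((P.map (incr s r)).prod (P.map (changeTime c))) := by
                rw [← hmap, lintegral_map hFm
                  ((measurable_incr s r).prodMk (measurable_changeTime c))]
            _ = ∫⁻ ω, (∫⁻ ω', F (incr s r ω, changeTime c ω') ∂P) ∂P := by
                rw [lintegral_prod _ hFm.aemeasurable,
                  lintegral_map hFm.lintegral_prod_right' (measurable_incr s r)]
                refine lintegral_congr fun ω => ?_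
                exact lintegral_map (hFm.comp measurable_prodMk_left) (measurable_changeTime c)
            _ = ∫⁻ ω, ENNReal.ofReal (W (x + incr s r ω)) * u r (x + incr s r ω) ∂P := by
                refine lintegral_congr fun ω => ?_
                simp only [hF, hct, hu]
                rw [lintegral_const_mul']
                exact ENNReal.ofReal_ne_top
            _ ≤ ∫⁻ ω, ENNReal.ofReal (W (x + incr s r ω)) * M ∂P := by
                refine lintegral_mono fun ω => ?_
                gcongr
                exact huM r hr' _
            _ = _ := lintegral_mul_const' _ _ hMtop
      _ = 1 + (∫⁻ r in Set.Ioc s 1, ∫⁻ ω, ENNReal.ofReal (W (x + incr s r ω)) ∂P) * M := by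
          rw [lintegral_mul_const' _ _ hMtop]
      _ ≤ 1 + 2⁻¹ * M := by
          gcongr
          exact hsmall s hs x
  have hM1 : M ≤ 1 + 2⁻¹ * M := iSup₂_le fun s hs => iSup_le fun x => hstep s hs x
  refine (huM s hs x).trans ?_
  clear_value M
  lift M to NNReal using hMtop
  have h2 : M ≤ 1 + 2⁻¹ * M := by
    have h3 : ((2⁻¹ : NNReal) : ℝ≥0∞) = 2⁻¹ := by simp
    rw [← h3] at hM1
    exact_mod_cast hM1
  have h4 : (M : ℝ) ≤ 1 + 2⁻¹ * M := by exact_mod_cast h2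
  have h5 : (M : ℝ) ≤ 2 := by linarith
  exact_mod_cast h5

end ExponentialMoment

/-! ### The entropy bound for the potential -/

section Entropy

theorem lintegral_inv_sqrt_sqrt_pow_le {s : ℝ} (hs : s ∈ Set.Icc (0 : ℝ) 1) :
    ∫⁻ r in Set.Ioc s 1, ENNReal.ofReal (((√√(r - s))⁻¹) ^ 3) ≤ ENNReal.ofReal 4 := by
  have h1 : ∀ r ∈ Set.Ioc s 1, ((√√(r - s))⁻¹) ^ 3 = (r - s) ^ (-(3 / 4) : ℝ) := by
    intro r hr
    have hr0 : 0 ≤ r - s := by linarith [hr.1]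
    rw [Real.sqrt_eq_rpow, Real.sqrt_eq_rpow, ← Real.rpow_mul hr0, ← Real.rpow_neg hr0,
      ← Real.rpow_natCast, ← Real.rpow_mul hr0]
    norm_num
  have hint : IntervalIntegrable (fun r => (r - s) ^ (-(3 / 4) : ℝ)) volume s 1 := by
    have := (intervalIntegral.intervalIntegrable_rpow' (a := 0) (b := 1 - s)
      (r := -(3 / 4)) (by norm_num)).comp_sub_right s
    simpa using this
  rw [setLIntegral_congr_fun measurableSet_Ioc fun r hr => by rw [h1 r hr],
    ← ofReal_integral_eq_lintegral_ofReal, ← intervalIntegral.integral_of_le hs.2]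
  · refine ENNReal.ofReal_le_ofReal ?_
    rw [intervalIntegral.integral_comp_sub_right (fun r => r ^ (-(3 / 4) : ℝ)),
      integral_rpow (Or.inl (by norm_num)), sub_self, Real.zero_rpow (by norm_num)]
    have : (1 - s) ^ (-(3 / 4) + 1 : ℝ) ≤ 1 :=
      Real.rpow_le_one (by linarith [hs.2]) (by linarith [hs.1]) (by norm_num)
    rw [div_le_iff₀ (by norm_num)]
    linarith
  · exact (intervalIntegrable_iff_integrableOn_Ioc_of_le hs.2).1 hint
  · filter_upwards [ae_restrict_mem measurableSet_Ioc] with r hr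
    exact Real.rpow_nonneg (by linarith [hr.1]) _

theorem IsBrownianIncrementLaw.lintegral_softPotential_le
    {P : Measure (IncrementSpace 3)} (hP : IsBrownianIncrementLaw P) {δ : ℝ} (hδ : 0 < δ)
    {s : ℝ} (hs : s ∈ Set.Icc (0 : ℝ) 1) (x : EuclideanSpace ℝ (Fin 3)) :
    ∫⁻ r in Set.Ioc s 1, ∫⁻ ω, ENNReal.ofReal (1000⁻¹ * softPotential δ (x + incr s r ω)) ∂P ≤
      2⁻¹ := by
  have := hP.isProbabilityMeasure
  have hc : Continuous fun y => softPotential δ (x + y) :=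
    (continuous_softPotential hδ).comp (continuous_const_add x)
  -- The factor `1000⁻¹` is chosen for this: `125 / 1000 = 1/8` from the Gaussian bound, times 4
  -- from the time integral, is exactly `1/2`.
  calc _ ≤ ∫⁻ r in Set.Ioc s 1, ENNReal.ofReal 8⁻¹ * ENNReal.ofReal (((√√(r - s))⁻¹) ^ 3) := by
        refine setLIntegral_mono' measurableSet_Ioc fun r hr => ?_
        have hrs : 0 < r - s := by linarith [hr.1]
        rw [← ofReal_integral_eq_lintegral_ofReal]
        · rw [← ENNReal.ofReal_mul (by norm_num), integral_const_mul]
          refine ENNReal.ofReal_le_ofReal ?_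
          have h1 := (hP.law s r hr.1.le).integral_comp (f := fun y => softPotential δ (x + y))
            hc.aestronglyMeasurable
          have h2 := integral_softPotential_gaussian_le hδ (Real.toNNReal_pos.2 hrs) x
          rw [Real.coe_toNNReal _ hrs.le] at h2
          rw [Function.comp_def] at h1
          rw [h1]
          linarith
        · refine Integrable.of_bound
            ((hc.comp (continuous_incr s r)).const_smul (1000⁻¹ : ℝ)).aestronglyMeasurable
            (1000⁻¹ * (δ * √δ)⁻¹) (ae_of_all _ fun ω => ?_)
          have h0 := softPotential_nonneg hδ (x + incr s r ω)
          rw [Real.norm_of_nonneg (by positivity)]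
          gcongr
          exact softPotential_le hδ _
        · exact ae_of_all _ fun ω => mul_nonneg (by norm_num) (softPotential_nonneg hδ _)
    _ = ENNReal.ofReal 8⁻¹ * ∫⁻ r in Set.Ioc s 1, ENNReal.ofReal (((√√(r - s))⁻¹) ^ 3) :=
        lintegral_const_mul' _ _ ENNReal.ofReal_ne_top
    _ ≤ ENNReal.ofReal 8⁻¹ * ENNReal.ofReal 4 := by
        gcongr
        exact lintegral_inv_sqrt_sqrt_pow_le hs
    _ = 2⁻¹ := by
        rw [← ENNReal.ofReal_mul (by norm_num), ← ENNReal.ofReal_ofNat,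
          ← ENNReal.ofReal_inv_of_pos (by norm_num)]
        norm_num

variable {d : ℕ}

theorem measurable_incr_incrSigma {S : Set ℝ} {s t : ℝ} (hs : s ∈ S) (ht : t ∈ S) :
    Measurable[incrSigma S] (incr s t : IncrementSpace d → _) := by
  have key : ∀ {a b : ℝ}, a ∈ S → b ∈ S → a < b →
      Measurable[incrSigma S] (incr a b : IncrementSpace d → _) := fun {a b} ha hb hab =>
    Measurable.mono (comap_measurable _) (le_iSup₂_of_le a ha (le_iSup₂_of_le b hb
      (le_iSup_of_le hab le_rfl))) le_rfl
  rcases lt_trichotomy s t with h | rfl | h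
  · exact key hs ht h
  · have : (incr s s : IncrementSpace d → _) = fun _ => 0 := funext fun ω => incr_self s ω
    rw [this]
    exact measurable_const
  · have : (incr s t : IncrementSpace d → _) = fun ω => -incr t s ω := by
      ext1 ω
      rw [eq_neg_iff_add_eq_zero, incr_add, incr_self]
    rw [this]
    exact (key ht hs h).neg

theorem incrSigma_le (S : Set ℝ) :
    incrSigma S ≤ (inferInstance : MeasurableSpace (IncrementSpace d)) :=
  iSup₂_le fun r _ => iSup₂_le fun s _ => iSup_le fun _ => (measurable_incr r s).comap_le

variable {W : EuclideanSpace ℝ (Fin d) → ℝ}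

theorem measurable_integral_potential_incrSigma (hW : Continuous W) (x : EuclideanSpace ℝ (Fin d)) :
    Measurable[incrSigma (Set.Icc 0 1)] fun ω : IncrementSpace d =>
      ∫ q in (0 : ℝ)..1, W (x + incr 0 q ω) := by
  -- Clamping times to `[0, 1]` does not change the integral and makes every increment measurable
  -- for the σ-algebra of `[0, 1]`.
  set c : C(ℝ, ℝ) := ⟨fun u => max 0 (min 1 u), by fun_prop⟩ with hc
  have hmem : ∀ u, c u ∈ Set.Icc (0 : ℝ) 1 := fun u =>
    ⟨le_max_left _ _, max_le zero_le_one (min_le_left _ _)⟩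
  have h1 : (fun ω : IncrementSpace d => ∫ q in (0 : ℝ)..1, W (x + incr 0 q ω)) =
      (fun ω => ∫ q in (0 : ℝ)..1, W (x + incr 0 q ω)) ∘ changeTime c := by
    ext1 ω
    refine intervalIntegral.integral_congr fun q hq => ?_
    rw [Set.uIcc_of_le zero_le_one] at hq
    simp [incr_changeTime, hc, hq.1, hq.2]
  rw [h1]
  have h2 : Measurable fun ω : IncrementSpace d => ∫ q in (0 : ℝ)..1, W (x + incr 0 q ω) :=
    ((continuous_integral_potential hW 0 1).comp
      (continuous_const.prodMk continuous_id)).measurable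
  exact h2.comp (measurable_of_measurable_incr fun s t =>
    measurable_incr_incrSigma (hmem s) (hmem t))

/-- Joining `μ`, restricted to `m`, with its conditional kernel gives the image of `μ` under the
diagonal. An `m`-measurable `X` can therefore be treated as a constant under the conditional law. -/
theorem lintegral_condExpKernel_comp {Ω E : Type*} {m : MeasurableSpace Ω} [mΩ : MeasurableSpace Ω]
    [StandardBorelSpace Ω] [MeasurableSpace E] {μ : Measure Ω} [IsFiniteMeasure μ] (hm : m ≤ mΩ)
    {X : Ω → E} (hX : Measurable[m] X) {F : E × Ω → ℝ≥0∞} (hF : Measurable F) :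
    ∫⁻ ω, ∫⁻ ω', F (X ω, ω') ∂(condExpKernel μ m ω) ∂μ = ∫⁻ ω, F (X ω, ω) ∂μ := by
  have hG : @Measurable (Ω × Ω) ℝ≥0∞ (m.prod mΩ) _ fun p => F (X p.1, p.2) :=
    hF.comp ((hX.comp measurable_fst).prodMk measurable_snd)
  have h1 := @Measure.lintegral_compProd Ω Ω m mΩ (μ.trim hm) (condExpKernel μ m) _ _ _ hG
  rw [compProd_trim_condExpKernel hm] at h1
  have hdiag : @Measurable Ω (Ω × Ω) mΩ (m.prod mΩ) Function.diag :=
    (measurable_id'' hm).prodMk measurable_id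
  rw [@lintegral_map Ω (Ω × Ω) mΩ (m.prod mΩ) _ _ _ hG hdiag] at h1
  rw [← lintegral_trim hm]
  · exact h1.symm
  · exact @Measurable.lintegral_kernel_prod_right' Ω Ω m mΩ (condExpKernel μ m) _ _ hG

/-- The entropy inequality, with the bounded function chosen depending on the past. -/
theorem lintegral_integral_potential_le {P Q : Measure (IncrementSpace d)} [IsProbabilityMeasure P]
    [IsProbabilityMeasure Q] (hW : Continuous W) (hW0 : ∀ x, 0 ≤ W x) {k : ℝ} (hk : ∀ x, W x ≤ k)
    (hexp : ∀ x, ∫⁻ ω, ENNReal.ofReal (Real.exp (∫ q in (0 : ℝ)..1, W (x + incr 0 q ω))) ∂P ≤ 2)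
    {X : IncrementSpace d → EuclideanSpace ℝ (Fin d)} (hX : Measurable[incrSigma (Set.Iic 0)] X) :
    ∫⁻ ω, ENNReal.ofReal (∫ q in (0 : ℝ)..1, W (X ω + incr 0 q ω)) ∂Q ≤
      specificEntropy Q P + ENNReal.ofReal (Real.log 2) := by
  have hcont := continuous_integral_potential hW 0 1
  have hcx : ∀ x, Continuous fun ω : IncrementSpace d => ∫ q in (0 : ℝ)..1, W (x + incr 0 q ω) :=
    fun x => hcont.comp (continuous_const.prodMk continuous_id)
  have h0 : ∀ x (ω : IncrementSpace d), 0 ≤ ∫ q in (0 : ℝ)..1, W (x + incr 0 q ω) := fun x ω =>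
    intervalIntegral.integral_nonneg zero_le_one fun q _ => hW0 _
  have hle : ∀ x (ω : IncrementSpace d), ∫ q in (0 : ℝ)..1, W (x + incr 0 q ω) ≤ k := fun x ω => by
    simpa using integral_potential_le hW hk zero_le_one x ω
  have hbd : ∀ x (ω : IncrementSpace d), ‖∫ q in (0 : ℝ)..1, W (x + incr 0 q ω)‖ ≤ k := fun x ω => by
    rw [Real.norm_of_nonneg (h0 x ω)]
    exact hle x ω
  -- The variational formula tested with the additive functional started at a fixed `x`; its
  -- exponential moment contributes at most `log 2`.
  have hpt : ∀ (μ : Measure (IncrementSpace d)) [IsProbabilityMeasure μ] x,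
      ∫⁻ ω, ENNReal.ofReal (∫ q in (0 : ℝ)..1, W (x + incr 0 q ω)) ∂μ ≤
        relEntropyOn (Set.Icc 0 1) μ P + ENNReal.ofReal (Real.log 2) := by
    intro μ _ x
    set f : IncrementSpace d →ᵇ ℝ := BoundedContinuousFunction.ofNormedAddCommGroup
      (fun ω => ∫ q in (0 : ℝ)..1, W (x + incr 0 q ω)) (hcx x) k (hbd x) with hf
    have hint : Integrable (fun ω => f ω) μ := f.integrable μ
    have h1 : ENNReal.ofReal (∫ ω, f ω ∂μ - Real.log (∫ ω, Real.exp (f ω) ∂P)) ≤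
        relEntropyOn (Set.Icc 0 1) μ P :=
      le_iSup₂_of_le f (measurable_integral_potential_incrSigma hW x) le_rfl
    have hexpint : Integrable (fun ω => Real.exp (f ω)) P := by
      refine Integrable.of_bound (Real.continuous_exp.comp f.continuous).aestronglyMeasurable
        (Real.exp k) (ae_of_all _ fun ω => ?_)
      rw [Real.norm_of_nonneg (Real.exp_pos _).le]
      exact Real.exp_le_exp.2 (hle x ω)
    have h2 : ∫ ω, Real.exp (f ω) ∂P ≤ 2 := by
      have h := (ofReal_integral_eq_lintegral_ofReal hexpint
        (ae_of_all _ fun ω => (Real.exp_pos _).le)).trans_le (hexp x)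
      exact (ENNReal.ofReal_le_ofReal_iff (by norm_num)).1 (h.trans_eq (by simp))
    have h3 : 1 ≤ ∫ ω, Real.exp (f ω) ∂P := by
      have := integral_mono (integrable_const (1 : ℝ)) hexpint
        fun ω => Real.one_le_exp (h0 x ω)
      simpa using this
    have h4 : Real.log (∫ ω, Real.exp (f ω) ∂P) ≤ Real.log 2 :=
      Real.log_le_log (by linarith) h2
    calc _ = ENNReal.ofReal (∫ ω, f ω ∂μ) :=
          (ofReal_integral_eq_lintegral_ofReal hint (ae_of_all _ (h0 x))).symm
      _ = ENNReal.ofReal ((∫ ω, f ω ∂μ - Real.log (∫ ω, Real.exp (f ω) ∂P)) +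
            Real.log (∫ ω, Real.exp (f ω) ∂P)) := by ring_nf
      _ ≤ ENNReal.ofReal (∫ ω, f ω ∂μ - Real.log (∫ ω, Real.exp (f ω) ∂P)) +
            ENNReal.ofReal (Real.log (∫ ω, Real.exp (f ω) ∂P)) := ENNReal.ofReal_add_le
      _ ≤ _ := add_le_add h1 (ENNReal.ofReal_le_ofReal h4)
  have hF : Measurable fun p : EuclideanSpace ℝ (Fin d) × IncrementSpace d =>
      ENNReal.ofReal (∫ q in (0 : ℝ)..1, W (p.1 + incr 0 q p.2)) := hcont.measurable.ennreal_ofReal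
  -- Conditioning on the past freezes the starting point at `X ω`, to which `hpt` applies.
  rw [← lintegral_condExpKernel_comp (incrSigma_le _) hX hF]
  calc _ ≤ ∫⁻ ω, (relEntropyOn (Set.Icc 0 1) (condExpKernel Q (incrSigma (Set.Iic 0)) ω) P +
          ENNReal.ofReal (Real.log 2)) ∂Q := lintegral_mono fun ω => hpt _ _
    _ = _ := by
      rw [lintegral_add_right _ measurable_const]
      simp [specificEntropy, entropyUpTo]

/-- For a law with stationary increments and finite specific entropy, the mean of
`∫_n^{n+1} |ω(t) - ω(0)|^{-3/2} dt` is bounded uniformly in `n`. -/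
theorem lintegral_softPotential_le {P Q : Measure (IncrementSpace 3)}
    (hP : IsBrownianIncrementLaw P) [IsProbabilityMeasure Q]
    (hQ : Q ∈ stationaryIncrementLaws 3) {δ : ℝ} (hδ : 0 < δ) (n : ℕ) :
    ∫⁻ ω, (∫⁻ t in Set.Ioc (n : ℝ) (n + 1), ENNReal.ofReal (softPotential δ (incr 0 t ω))) ∂Q ≤
      1000 * (specificEntropy Q P + ENNReal.ofReal (Real.log 2)) := by
  have := hP.isProbabilityMeasure
  set W : EuclideanSpace ℝ (Fin 3) → ℝ := fun x => 1000⁻¹ * softPotential δ x with hWdef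
  have hW : Continuous W := (continuous_softPotential hδ).const_mul _
  have hW0 : ∀ x, 0 ≤ W x := fun x => mul_nonneg (by norm_num) (softPotential_nonneg hδ x)
  have hk : ∀ x, W x ≤ 1000⁻¹ * (δ * √δ)⁻¹ := fun x =>
    mul_le_mul_of_nonneg_left (softPotential_le hδ x) (by norm_num)
  have hexp := fun x => hP.lintegral_exp_integral_le_two hW hW0 hk
    (fun s hs x => hP.lintegral_softPotential_le hδ hs x) (s := 0) (by simp) x
  -- By stationarity `[n, n + 1]` is moved to `[0, 1]` and time 0 to `-n`; the displacement over
  -- `[-n, 0]` then belongs to the past, which is why the bound does not depend on `n`.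
  have hX : Measurable[incrSigma (Set.Iic 0)] (incr (-n) 0 : IncrementSpace 3 → _) :=
    measurable_incr_incrSigma (by simp) (by simp)
  have key := lintegral_integral_potential_le (Q := Q) hW hW0 hk hexp hX
  have hcw : ∀ ω : IncrementSpace 3, Continuous fun q => W (incr (-n) 0 ω + incr 0 q ω) := fun ω =>
    hW.comp (continuous_const.add (Continuous.incr continuous_const continuous_id continuous_const))
  have hmeas : Measurable fun ω : IncrementSpace 3 =>
      ∫⁻ t in Set.Ioc (0 : ℝ) 1, ENNReal.ofReal (softPotential δ (incr (-n) t ω)) := by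
    refine Measurable.lintegral_prod_right' (f := fun p : IncrementSpace 3 × ℝ =>
      ENNReal.ofReal (softPotential δ (incr (-n) p.2 p.1))) ?_
    exact ((continuous_softPotential hδ).comp
      (Continuous.incr continuous_const continuous_snd continuous_fst)).measurable.ennreal_ofReal
  calc _ = ∫⁻ ω, (∫⁻ t in Set.Ioc (0 : ℝ) 1,
          ENNReal.ofReal (softPotential δ (incr (-n) t (incrShift n ω)))) ∂Q := by
        refine lintegral_congr fun ω => ?_
        have h1 := (measurePreserving_add_right volume (n : ℝ)).setLIntegral_comp_preimage_emb
          (measurableEmbedding_addRight (n : ℝ))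
          (fun t => ENNReal.ofReal (softPotential δ (incr 0 t ω))) (Set.Ioc (n : ℝ) (n + 1))
        rw [← h1]
        have h2 : (fun x : ℝ => x + n) ⁻¹' Set.Ioc (n : ℝ) (n + 1) = Set.Ioc 0 1 := by
          ext t
          simp
        rw [h2]
        refine lintegral_congr fun t => ?_
        have h3 : incr (-n) t (incrShift n ω) = incr (-n + n) (t + n) ω := rfl
        rw [h3, neg_add_cancel]
    _ = ∫⁻ ω, (∫⁻ t in Set.Ioc (0 : ℝ) 1, ENNReal.ofReal (softPotential δ (incr (-n) t ω))) ∂Q :=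
        (hQ.2 n).lintegral_comp hmeas
    _ = ∫⁻ ω, 1000 * ENNReal.ofReal (∫ q in (0 : ℝ)..1, W (incr (-n) 0 ω + incr 0 q ω)) ∂Q := by
        refine lintegral_congr fun ω => ?_
        rw [intervalIntegral.integral_of_le zero_le_one, ofReal_integral_eq_lintegral_ofReal
          (hcw ω).integrableOn_Ioc (ae_of_all _ fun q => hW0 _),
          ← lintegral_const_mul' _ _ (by simp)]
        refine lintegral_congr fun t => ?_
        rw [incr_add, hWdef, ← ENNReal.ofReal_ofNat, ← ENNReal.ofReal_mul (by norm_num)]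
        congr 1
        ring
    _ = 1000 * ∫⁻ ω, ENNReal.ofReal (∫ q in (0 : ℝ)..1, W (incr (-n) 0 ω + incr 0 q ω)) ∂Q :=
        lintegral_const_mul' _ _ (by simp)
    _ ≤ _ := by gcongr

end Entropy

/-! ### The weak Abel ergodic theorem -/

section Abel

theorem integral_Ioi_exp_neg_mul {ε : ℝ} (hε : 0 < ε) :
    ∫ t in Set.Ioi (0 : ℝ), Real.exp (-ε * t) = ε⁻¹ := by
  rw [integral_exp_mul_Ioi (by linarith)]
  simp

theorem integrableOn_exp_mul_of_bound {c : ℝ → ℝ} (hc : Continuous c) {B : ℝ} (hB : ∀ t, |c t| ≤ B)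
    {ε : ℝ} (hε : 0 < ε) (s : ℝ) :
    IntegrableOn (fun t => Real.exp (-ε * t) * c t) (Set.Ioi s) :=
  (integrableOn_exp_mul_Ioi (by linarith) s).mul_bdd hc.aestronglyMeasurable
    (ae_of_all _ fun t => hB t)

theorem abs_mul_integral_exp_mul_le {c : ℝ → ℝ} {B : ℝ} (hB : ∀ t, |c t| ≤ B)
    {ε : ℝ} (hε : 0 < ε) :
    |ε * ∫ t in Set.Ioi (0 : ℝ), Real.exp (-ε * t) * c t| ≤ B := by
  have h1 : ‖∫ t in Set.Ioi (0 : ℝ), Real.exp (-ε * t) * c t‖ ≤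
      ∫ t in Set.Ioi (0 : ℝ), Real.exp (-ε * t) * B := by
    refine norm_integral_le_of_norm_le
      ((integrableOn_exp_mul_Ioi (by linarith) 0).mul_const B) (ae_of_all _ fun t => ?_)
    rw [norm_mul, Real.norm_of_nonneg (Real.exp_pos _).le]
    gcongr
    exact hB t
  rw [integral_mul_const, integral_Ioi_exp_neg_mul hε] at h1
  rw [abs_mul, abs_of_pos hε]
  calc _ ≤ ε * (ε⁻¹ * B) := by
        gcongr
        exact h1
    _ = B := by field_simp

/-- The Abel means of `c(t + s) - c(t)` tend to zero for a bounded continuous function `c`. -/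
theorem tendsto_abel_mean_sub {c : ℝ → ℝ} (hc : Continuous c) {B : ℝ} (hB : ∀ t, |c t| ≤ B)
    {s : ℝ} (hs : 0 ≤ s) :
    Tendsto (fun ε => ε * ∫ t in Set.Ioi (0 : ℝ), Real.exp (-ε * t) * (c (t + s) - c t))
      (𝓝[>] 0) (𝓝 0) := by
  have hB0 : 0 ≤ B := (abs_nonneg _).trans (hB 0)
  have hbound : ∀ ε > 0, |ε * ∫ t in Set.Ioi (0 : ℝ), Real.exp (-ε * t) * (c (t + s) - c t)| ≤
      (Real.exp (ε * s) - 1) * B + ε * (Real.exp (ε * s) * (s * B)) := by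
    intro ε hε
    have hcs : Continuous fun t => c (t + s) := by fun_prop
    have h1 : ∫ t in Set.Ioi (0 : ℝ), Real.exp (-ε * t) * c (t + s) =
        Real.exp (ε * s) * ∫ t in Set.Ioi s, Real.exp (-ε * t) * c t := by
      have h2 := (measurePreserving_add_right volume s).setIntegral_preimage_emb
        (measurableEmbedding_addRight s) (fun t => Real.exp (-ε * t) * c t) (Set.Ioi s)
      rw [Set.preimage_add_const_Ioi, sub_self] at h2
      rw [← h2, ← integral_const_mul]
      refine integral_congr_ae (ae_of_all _ fun t => ?_)
      simp only
      rw [← mul_assoc, ← Real.exp_add]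
      ring_nf
    have h3 : ∫ t in Set.Ioi (0 : ℝ), Real.exp (-ε * t) * c t =
        (∫ t in Set.Ioc 0 s, Real.exp (-ε * t) * c t) +
          ∫ t in Set.Ioi s, Real.exp (-ε * t) * c t := by
      rw [← Set.Ioc_union_Ioi_eq_Ioi hs, setIntegral_union (Set.Ioc_disjoint_Ioi le_rfl)
        measurableSet_Ioi ((integrableOn_exp_mul_of_bound hc hB hε 0).mono_set
          Set.Ioc_subset_Ioi_self) (integrableOn_exp_mul_of_bound hc hB hε s)]
    -- Shifting by `s` costs only a change of weight by `exp (ε s)` and a boundary term over `(0,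
    -- s]`; after multiplication by `ε` both vanish in the limit.
    have h4 : ∫ t in Set.Ioi (0 : ℝ), Real.exp (-ε * t) * (c (t + s) - c t) =
        (Real.exp (ε * s) - 1) * (∫ t in Set.Ioi (0 : ℝ), Real.exp (-ε * t) * c t) -
          Real.exp (ε * s) * ∫ t in Set.Ioc 0 s, Real.exp (-ε * t) * c t := by
      simp_rw [mul_sub]
      rw [integral_sub (integrableOn_exp_mul_of_bound hcs (fun t => hB _) hε 0)
        (integrableOn_exp_mul_of_bound hc hB hε 0), h1]
      rw [eq_sub_of_add_eq' h3.symm]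
      ring
    have h5 := abs_mul_integral_exp_mul_le hB hε
    have h6 : |∫ t in Set.Ioc 0 s, Real.exp (-ε * t) * c t| ≤ s * B := by
      have := norm_setIntegral_le_of_norm_le_const (μ := volume) (s := Set.Ioc 0 s)
        (f := fun t => Real.exp (-ε * t) * c t) (C := B) (by simp) (fun t ht => by
          rw [norm_mul, Real.norm_of_nonneg (Real.exp_pos _).le]
          have : Real.exp (-ε * t) ≤ 1 := Real.exp_le_one_iff.2 (by nlinarith [ht.1])
          calc _ ≤ 1 * B := by
                gcongr
                exact hB t
            _ = B := one_mul B)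
      rw [Real.volume_real_Ioc_of_le hs, sub_zero, mul_comm] at this
      exact this
    have he : 0 ≤ Real.exp (ε * s) - 1 := by
      have := Real.one_le_exp (mul_nonneg hε.le hs)
      linarith
    rw [h4]
    calc _ = |(Real.exp (ε * s) - 1) * (ε * ∫ t in Set.Ioi (0 : ℝ), Real.exp (-ε * t) * c t) -
          ε * (Real.exp (ε * s) * ∫ t in Set.Ioc 0 s, Real.exp (-ε * t) * c t)| := by
          congr 1
          ring
      _ ≤ _ := by
          refine (abs_sub _ _).trans (add_le_add ?_ ?_)
          · rw [abs_mul, abs_of_nonneg he]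
            gcongr
          · rw [abs_mul, abs_mul, abs_of_pos hε, abs_of_pos (Real.exp_pos _)]
            gcongr
  have hlim : Tendsto (fun ε : ℝ => (Real.exp (ε * s) - 1) * B + ε * (Real.exp (ε * s) * (s * B)))
      (𝓝[>] 0) (𝓝 0) := by
    have hcont : Continuous fun ε : ℝ =>
        (Real.exp (ε * s) - 1) * B + ε * (Real.exp (ε * s) * (s * B)) := by fun_prop
    have := hcont.tendsto 0
    simp only [zero_mul, Real.exp_zero, sub_self, add_zero] at this
    exact this.mono_left nhdsWithin_le_nhds
  refine squeeze_zero_norm' ?_ hlim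
  filter_upwards [self_mem_nhdsWithin] with ε hε using hbound ε hε

/-- The weak Abel ergodic theorem for a semigroup of linear isometries: if `g` is orthogonal to all
invariant vectors, then the Abel means of its correlations tend to zero. -/
theorem tendsto_abel_mean_inner {H : Type*} [NormedAddCommGroup H] [InnerProductSpace ℝ H]
    [CompleteSpace H] (U : ℝ → H →ₗᵢ[ℝ] H) (hadd : ∀ s t h, U t (U s h) = U (t + s) h)
    (hcont : ∀ h, Continuous fun t => U t h) (g : H)
    (hg : ∀ ψ : H, (∀ s, 0 ≤ s → U s ψ = ψ) → inner ℝ ψ g = 0) :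
    Tendsto (fun ε => ε * ∫ t in Set.Ioi (0 : ℝ), Real.exp (-ε * t) * inner ℝ g (U t g))
      (𝓝[>] 0) (𝓝 0) := by
  set A : ℝ → H → ℝ := fun ε h =>
    ε * ∫ t in Set.Ioi (0 : ℝ), Real.exp (-ε * t) * inner ℝ g (U t h) with hA
  have hc : ∀ h, Continuous fun t => inner ℝ g (U t h) := fun h => continuous_const.inner (hcont h)
  have hB : ∀ h t, |inner ℝ g (U t h)| ≤ ‖g‖ * ‖h‖ := fun h t => by
    have := abs_real_inner_le_norm g (U t h)
    rwa [LinearIsometry.norm_map] at this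
  have hAadd : ∀ ε > 0, ∀ h k, A ε (h + k) = A ε h + A ε k := by
    intro ε hε h k
    simp only [hA, map_add, inner_add_right, mul_add]
    rw [integral_add (integrableOn_exp_mul_of_bound (hc h) (hB h) hε 0)
      (integrableOn_exp_mul_of_bound (hc k) (hB k) hε 0), mul_add]
  have hAsmul : ∀ ε (a : ℝ) h, A ε (a • h) = a * A ε h := by
    intro ε a h
    simp only [hA, map_smul, inner_smul_right]
    simp_rw [mul_left_comm _ a]
    rw [integral_const_mul]
    ring
  have hAbd : ∀ ε > 0, ∀ h, |A ε h| ≤ ‖g‖ * ‖h‖ := fun ε hε h => abs_mul_integral_exp_mul_le (hB h) hε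
  set K : Submodule ℝ H := Submodule.span ℝ {k | ∃ s h, 0 ≤ s ∧ k = U s h - h} with hK
  have hKtend : ∀ k ∈ K, Tendsto (fun ε => A ε k) (𝓝[>] 0) (𝓝 0) := by
    intro k hk
    induction hk using Submodule.span_induction with
    | mem k hk =>
      obtain ⟨s, h, hs, rfl⟩ := hk
      have := tendsto_abel_mean_sub (hc h) (hB h) hs
      simpa only [hA, map_sub, inner_sub_right, hadd] using this
    | zero => simp [hA]
    | add h k _ _ ih1 ih2 =>
      have := ih1.add ih2
      rw [add_zero] at this
      refine this.congr' ?_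
      filter_upwards [self_mem_nhdsWithin] with ε hε using (hAadd ε hε h k).symm
    | smul a h _ ih =>
      have := ih.const_mul a
      rw [mul_zero] at this
      exact this.congr fun ε => (hAsmul ε a h).symm
  -- A vector `ψ` orthogonal to all coboundaries satisfies `⟨U s ψ, ψ⟩ = ‖ψ‖²`, and as `U s` is an
  -- isometry this forces `U s ψ = ψ`. So `g` is orthogonal to the complement of `K`.
  have hgK : g ∈ K.topologicalClosure := by
    rw [← Submodule.orthogonal_orthogonal_eq_closure, Submodule.mem_orthogonal]
    intro ψ hψ
    refine hg ψ fun s hs => ?_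
    have h1 : inner ℝ (U s ψ - ψ) ψ = 0 :=
      (Submodule.mem_orthogonal K ψ).1 hψ _ (Submodule.subset_span ⟨s, ψ, hs, rfl⟩)
    rw [inner_sub_left, real_inner_self_eq_norm_sq] at h1
    have h2 := norm_sub_sq_real (U s ψ) ψ
    rw [LinearIsometry.norm_map] at h2
    have h3 : ‖U s ψ - ψ‖ ^ 2 = 0 := by linarith
    exact sub_eq_zero.1 (norm_eq_zero.1 (pow_eq_zero_iff two_ne_zero |>.1 h3))
  rw [Metric.tendsto_nhds]
  intro η hη
  have hgc : g ∈ closure (K : Set H) := hgK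
  obtain ⟨k, hk, hgk⟩ := Metric.mem_closure_iff.1 hgc (η / 2 / (‖g‖ + 1)) (by positivity)
  have h4 := (Metric.tendsto_nhds.1 (hKtend k hk)) (η / 2) (by positivity)
  filter_upwards [h4, self_mem_nhdsWithin] with ε h5 hε
  rw [Real.dist_eq, sub_zero] at h5 ⊢
  have h6 : A ε g = A ε k + A ε (g - k) := by
    rw [← hAadd ε hε, add_sub_cancel]
  have h7 : |A ε (g - k)| ≤ η / 2 := by
    refine (hAbd ε hε _).trans ?_
    rw [dist_eq_norm, lt_div_iff₀ (by positivity)] at hgk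
    nlinarith [norm_nonneg (g - k)]
  change |A ε g| < η
  rw [h6]
  calc _ ≤ |A ε k| + |A ε (g - k)| := abs_add_le _ _
    _ < η := by linarith

end Abel

/-! ### Ergodicity from extremality -/

section Ergodic

variable {d : ℕ}

theorem measurable_incrShift (v : ℝ) : Measurable (incrShift v : IncrementSpace d → _) :=
  measurable_of_measurable_incr fun s t => measurable_incr (s + v) (t + v)

theorem incrShift_incrShift_neg (v : ℝ) (ω : IncrementSpace d) :
    incrShift v (incrShift (-v) ω) = ω := by
  refine Subtype.ext (ContinuousMap.ext fun p => ?_)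
  change ω.1 (p.1 + v + -v, p.2 + v + -v) = ω.1 p
  rw [add_neg_cancel_right, add_neg_cancel_right]

theorem incrShift_neg_incrShift (v : ℝ) (ω : IncrementSpace d) :
    incrShift (-v) (incrShift v ω) = ω := by
  simpa using incrShift_incrShift_neg (-v) ω

theorem measurePreserving_restrict_of_preimage_ae_eq {Ω : Type*} [MeasurableSpace Ω]
    {μ : Measure Ω} {f : Ω → Ω} (hf : MeasurePreserving f μ μ) {A : Set Ω} (hA : MeasurableSet A)
    (h : f ⁻¹' A =ᵐ[μ] A) : MeasurePreserving f (μ.restrict A) (μ.restrict A) := by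
  have := hf.restrict_preimage hA
  rwa [Measure.restrict_congr_set h] at this

theorem measurePreserving_withDensity {Ω : Type*} [MeasurableSpace Ω] {μ : Measure Ω} {f : Ω → Ω}
    (hf : MeasurePreserving f μ μ) {ρ : Ω → ℝ≥0∞} (hρ : Measurable ρ)
    (h : (fun x => ρ (f x)) =ᵐ[μ] ρ) :
    MeasurePreserving f (μ.withDensity ρ) (μ.withDensity ρ) := by
  refine ⟨hf.measurable, Measure.ext fun A hA => ?_⟩
  rw [Measure.map_apply hf.measurable hA, withDensity_apply _ (hf.measurable hA),
    withDensity_apply _ hA, ← hf.setLIntegral_comp_preimage hA hρ]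
  exact lintegral_congr_ae (ae_restrict_of_ae h.symm)

/-- A set that is invariant up to null sets under all shifts is trivial for an ergodic law. -/
theorem measure_eq_zero_or_of_ergodic {Q : Measure (IncrementSpace d)}
    (hQ : Q ∈ ergodicIncrementLaws d) {A : Set (IncrementSpace d)} (hA : MeasurableSet A)
    (hinv : ∀ v, incrShift v ⁻¹' A =ᵐ[Q] A) : Q A = 0 ∨ Q Aᶜ = 0 := by
  obtain ⟨⟨hprob, hst⟩, hext⟩ := hQ
  by_contra! hne
  have hmem : ∀ B : Set (IncrementSpace d), MeasurableSet B → (∀ v, incrShift v ⁻¹' B =ᵐ[Q] B) →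
      Q B ≠ 0 → (Q B)⁻¹ • Q.restrict B ∈ stationaryIncrementLaws d := by
    intro B hB hinvB hB0
    refine ⟨⟨?_⟩, fun v =>
      (measurePreserving_restrict_of_preimage_ae_eq (hst v) hB (hinvB v)).smul_measure _⟩
    simp [ENNReal.inv_mul_cancel hB0 (measure_ne_top Q B)]
  have hinvc : ∀ v, incrShift v ⁻¹' Aᶜ =ᵐ[Q] Aᶜ := fun v => (hinv v).compl
  -- If `A` were nontrivial, `Q` would be a proper mixture of its conditional laws on `A` and `Aᶜ`,
  -- both with stationary increments; extremality would make `Q` equal to the first, which does not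
  -- charge `Aᶜ`.
  have hseg : Q ∈ openSegment ℝ≥0∞ ((Q A)⁻¹ • Q.restrict A) ((Q Aᶜ)⁻¹ • Q.restrict Aᶜ) := by
    refine ⟨Q A, Q Aᶜ, pos_iff_ne_zero.2 hne.1, pos_iff_ne_zero.2 hne.2, ?_, ?_⟩
    · rw [measure_add_measure_compl hA, measure_univ]
    · rw [smul_smul, smul_smul, ENNReal.mul_inv_cancel hne.1 (measure_ne_top Q A),
        ENNReal.mul_inv_cancel hne.2 (measure_ne_top Q Aᶜ), one_smul, one_smul,
        Measure.restrict_add_restrict_compl hA]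
  have heq := hext (hmem A hA hinv hne.1) (hmem Aᶜ hA.compl hinvc hne.2) hseg
  refine hne.2 ?_
  have h1 : ((Q A)⁻¹ • Q.restrict A) Aᶜ = 0 := by
    rw [Measure.smul_apply, Measure.restrict_apply hA.compl, Set.compl_inter_self]
    simp
  rwa [heq] at h1

/-- A finite shift-invariant measure that is absolutely continuous with respect to an ergodic law is
a multiple of it. -/
theorem exists_eq_smul_of_ergodic {Q ν : Measure (IncrementSpace d)} [IsProbabilityMeasure Q]
    [IsFiniteMeasure ν] (hQ : Q ∈ ergodicIncrementLaws d) (hac : ν ≪ Q)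
    (hν : ∀ v, MeasurePreserving (incrShift v) ν ν) : ∃ c : ℝ≥0∞, ν = c • Q := by
  have hst := hQ.1.2
  set ρ := ν.rnDeriv Q with hρ
  have hρm : Measurable ρ := Measure.measurable_rnDeriv ν Q
  have hwd : Q.withDensity ρ = ν := Measure.withDensity_rnDeriv_eq ν Q hac
  -- Over any `B`, both sides have the same `Q`-integral: invariance of `Q` turns the left one into
  -- the `ν`-measure of the shifted set, which is `ν B` by invariance of `ν`.
  have hinv : ∀ v, (fun ω => ρ (incrShift v ω)) =ᵐ[Q] ρ := by
    intro v
    refine ae_eq_of_forall_setLIntegral_eq_of_sigmaFinite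
      (hρm.comp (measurable_incrShift v)) hρm fun B hB _ => ?_
    have hC : MeasurableSet (incrShift (-v) ⁻¹' B : Set (IncrementSpace d)) :=
      measurable_incrShift (-v) hB
    have hpre : incrShift v ⁻¹' (incrShift (-v) ⁻¹' B) = B := by
      ext ω
      simp [incrShift_neg_incrShift]
    have h1 := (hst v).setLIntegral_comp_preimage hC hρm
    have h2 := (hν v).measure_preimage hC.nullMeasurableSet
    rw [hpre] at h1 h2
    rw [h1, ← withDensity_apply _ hC, ← withDensity_apply _ hB, hwd, h2]
  -- All preimages under `ρ` are null or conull, and countably many measurable sets separate the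
  -- points of `[0, ∞]`.
  obtain ⟨c, hc⟩ : ∃ c, ρ =ᵐ[Q] Function.const _ c := by
    refine exists_eventuallyEq_const_of_forall_separating MeasurableSet fun U hU => ?_
    have hA : MeasurableSet (ρ ⁻¹' U) := hρm hU
    have hA' : ∀ v, incrShift v ⁻¹' (ρ ⁻¹' U) =ᵐ[Q] ρ ⁻¹' U := fun v => by
      refine eventuallyEq_set.2 ?_
      filter_upwards [hinv v] with ω hω
      simp only [Set.mem_preimage, hω]
    rcases measure_eq_zero_or_of_ergodic hQ hA hA' with h | h
    · right
      rw [ae_iff]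
      simpa [Set.preimage] using h
    · left
      rw [ae_iff]
      exact h
  refine ⟨c, ?_⟩
  rw [← hwd, withDensity_congr_ae hc]
  exact withDensity_const c

end Ergodic

/-! ### The invariant infinite measure on paths -/

section PathMeasure

variable {d : ℕ}

theorem measurable_eval (t : ℝ) : Measurable fun γ : PathSpace d => γ t :=
  (continuous_eval_const t).measurable

theorem measurable_of_measurable_eval {Ω : Type*} {m : MeasurableSpace Ω} {f : Ω → PathSpace d}
    (hf : ∀ t, Measurable fun x => f x t) : Measurable f := by
  rw [measurable_comap_iff]
  exact measurable_pi_lambda _ hf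

/-- The path with the given increments that is at the given point at time `0`. -/
def pathOf (p : IncrementSpace d × EuclideanSpace ℝ (Fin d)) : PathSpace d :=
  ⟨fun t => p.2 + incr 0 t p.1,
    continuous_const.add (Continuous.incr continuous_const continuous_id continuous_const)⟩

theorem pathOf_apply (ω : IncrementSpace d) (x : EuclideanSpace ℝ (Fin d)) (t : ℝ) :
    pathOf (ω, x) t = x + incr 0 t ω := rfl

theorem measurable_pathOf : Measurable (pathOf (d := d)) :=
  measurable_of_measurable_eval fun t =>
    measurable_snd.add ((measurable_incr 0 t).comp measurable_fst)

theorem incrementMap_pathOf (p : IncrementSpace d × EuclideanSpace ℝ (Fin d)) :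
    incrementMap (pathOf p) = p.1 := by
  refine Subtype.ext (ContinuousMap.ext fun q => ?_)
  change p.2 + incr 0 q.2 p.1 - (p.2 + incr 0 q.1 p.1) = incr q.1 q.2 p.1
  rw [add_sub_add_left_eq_sub, incr_sub]

theorem measurable_incrementMap : Measurable (incrementMap (d := d)) :=
  measurable_of_measurable_incr fun s t => (measurable_eval t).sub (measurable_eval s)

theorem measurable_pathShift (v : ℝ) : Measurable (pathShift v : PathSpace d → _) :=
  measurable_of_measurable_eval fun t => measurable_eval (t + v)

theorem pathShift_pathShift (s t : ℝ) (γ : PathSpace d) :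
    pathShift s (pathShift t γ) = pathShift (t + s) γ := by
  ext1 u
  change γ (u + s + t) = γ (u + (t + s))
  congr 1
  ring

theorem pathShift_zero (γ : PathSpace d) : pathShift 0 γ = γ := by
  ext1 u
  change γ (u + 0) = γ u
  rw [add_zero]

theorem pathShift_pathOf (v : ℝ) (ω : IncrementSpace d) (x : EuclideanSpace ℝ (Fin d)) :
    pathShift v (pathOf (ω, x)) = pathOf (incrShift v ω, x + incr 0 v ω) := by
  ext1 t
  change x + incr 0 (t + v) ω = x + incr 0 v ω + incr (0 + v) (t + v) ω
  rw [zero_add, add_assoc, incr_add]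

theorem continuous_pathShift_uncurry :
    Continuous fun p : ℝ × PathSpace d => pathShift p.1 p.2 := by
  refine ContinuousMap.continuous_of_continuous_uncurry _ ?_
  change Continuous fun q : (ℝ × PathSpace d) × ℝ => q.1.2 (q.2 + q.1.1)
  fun_prop

/-- The infinite measure on paths under which the increments have the law `Q` and the position at
time `0` is independent of them and distributed according to Lebesgue measure. -/
noncomputable def pathMeasure (Q : Measure (IncrementSpace d)) : Measure (PathSpace d) :=
  (Q.prod volume).map pathOf

theorem map_incrementMap_absolutelyContinuous {Q : Measure (IncrementSpace d)}
    {m : Measure (PathSpace d)}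
    (hm : m ≪ pathMeasure Q) : m.map incrementMap ≪ Q := by
  refine Measure.AbsolutelyContinuous.mk fun A hA h0 => ?_
  rw [Measure.map_apply measurable_incrementMap hA]
  refine hm ?_
  rw [pathMeasure, Measure.map_apply measurable_pathOf (measurable_incrementMap hA)]
  have : pathOf ⁻¹' (incrementMap ⁻¹' A) = A ×ˢ (Set.univ : Set (EuclideanSpace ℝ (Fin d))) := by
    ext p
    simp [incrementMap_pathOf]
  rw [this, Measure.prod_prod, h0, zero_mul]

variable {Q : Measure (IncrementSpace d)} [IsProbabilityMeasure Q]

/-- In the coordinates (increments, position at time 0) the shift is a skew product: it moves the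
increments by `incrShift v`, which preserves `Q`, and translates the position by `incr 0 v ω`, which
preserves Lebesgue measure. -/
theorem measurePreserving_pathShift (hQ : Q ∈ stationaryIncrementLaws d) (v : ℝ) :
    MeasurePreserving (pathShift v) (pathMeasure Q) (pathMeasure Q) := by
  have hskew : MeasurePreserving (fun p : IncrementSpace d × EuclideanSpace ℝ (Fin d) =>
      (incrShift v p.1, p.2 + incr 0 v p.1)) (Q.prod volume) (Q.prod volume) := by
    refine MeasurePreserving.skew_product (g := fun ω x => x + incr 0 v ω) (hQ.2 v) ?_
      (ae_of_all _ fun ω => ?_)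
    · exact measurable_snd.add ((measurable_incr 0 v).comp measurable_fst)
    · exact (measurePreserving_add_right volume (incr 0 v ω)).map_eq
  refine ⟨measurable_pathShift v, ?_⟩
  rw [pathMeasure, Measure.map_map (measurable_pathShift v) measurable_pathOf]
  have : pathShift v ∘ pathOf (d := d) = pathOf ∘ fun p => (incrShift v p.1, p.2 + incr 0 v p.1) :=
    funext fun p => pathShift_pathOf v p.1 p.2
  rw [this, ← Measure.map_map measurable_pathOf hskew.measurable, hskew.map_eq]

theorem pathMeasure_norm_eval_zero_le_lt_top (R : ℝ) :
    pathMeasure Q {γ | ‖γ 0‖ ≤ R} < ⊤ := by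
  have hm : MeasurableSet {γ : PathSpace d | ‖γ 0‖ ≤ R} :=
    measurableSet_le (measurable_eval 0).norm measurable_const
  rw [pathMeasure, Measure.map_apply measurable_pathOf hm]
  have : pathOf ⁻¹' {γ : PathSpace d | ‖γ 0‖ ≤ R} = Set.univ ×ˢ Metric.closedBall 0 R := by
    ext ⟨ω, x⟩
    simp [pathOf_apply, incr_self]
  rw [this, Measure.prod_prod, measure_univ, one_mul]
  exact measure_closedBall_lt_top

/-- Serves the strong continuity of the Koopman isometries. -/
instance : IsLocallyFiniteMeasure (pathMeasure Q) := by
  refine ⟨fun γ => ⟨{γ' | ‖γ' 0‖ < ‖γ 0‖ + 1}, ?_, ?_⟩⟩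
  · refine IsOpen.mem_nhds (isOpen_lt (by fun_prop) continuous_const) ?_
    simp
  · refine (measure_mono ?_).trans_lt (pathMeasure_norm_eval_zero_le_lt_top (‖γ 0‖ + 1))
    exact Set.ofPred_subset_ofPred.2 fun γ' h => le_of_lt h

/-- A nonzero shift-invariant square integrable function on the space of paths gives rise to a
stationary process with the given ergodic law of increments. -/
theorem exists_stationary_of_invariant (hQ : Q ∈ ergodicIncrementLaws d)
    {ψ : PathSpace d → ℝ} (hψm : Measurable ψ) (hψ : MemLp ψ 2 (pathMeasure Q))
    (hψ0 : ¬ ψ =ᵐ[pathMeasure Q] 0)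
    (hinv : ∀ s, 0 ≤ s → (fun γ => ψ (pathShift s γ)) =ᵐ[pathMeasure Q] ψ) :
    ∃ Q' ∈ stationaryLaws d, MeasurePreserving incrementMap Q' Q := by
  set ρ : PathSpace d → ℝ≥0∞ := fun γ => ‖ψ γ‖ₑ ^ (2 : ℝ) with hρ
  have hρm : Measurable ρ := hψm.enorm.pow_const 2
  set m := (pathMeasure Q).withDensity ρ with hm
  have hmfin : IsFiniteMeasure m := by
    refine isFiniteMeasure_withDensity ?_
    have := (eLpNorm_lt_top_iff_lintegral_rpow_enorm_lt_top (by norm_num) (by norm_num)).1 hψ.2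
    simpa [hρ] using this.ne
  have hm0 : m ≠ 0 := by
    intro h
    rw [hm, withDensity_eq_zero_iff hρm.aemeasurable] at h
    refine hψ0 ?_
    filter_upwards [h] with γ hγ
    simpa [hρ] using hγ
  have hpos : ∀ s, 0 ≤ s → MeasurePreserving (pathShift s) m m := fun s hs => by
    refine measurePreserving_withDensity (measurePreserving_pathShift hQ.1 s) hρm ?_
    filter_upwards [hinv s hs] with γ hγ
    simp only [hρ, hγ]
  have hall : ∀ v, MeasurePreserving (pathShift v) m m := by
    intro v
    rcases le_total 0 v with hv | hv
    · exact hpos v hv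
    -- A negative shift is the inverse of a measure-preserving one.
    · refine ⟨measurable_pathShift v, ?_⟩
      have h1 := hpos (-v) (by linarith)
      conv_lhs => rw [← h1.map_eq]
      rw [Measure.map_map (measurable_pathShift v) (measurable_pathShift (-v))]
      have : pathShift v ∘ pathShift (-v) = (id : PathSpace d → PathSpace d) := by
        ext1 γ
        rw [Function.comp_apply, pathShift_pathShift, neg_add_cancel, pathShift_zero, id]
      rw [this, Measure.map_id]
  set ν := m.map incrementMap with hν
  have hνinv : ∀ v, MeasurePreserving (incrShift v) ν ν := by
    intro v
    refine ⟨measurable_incrShift v, ?_⟩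
    rw [hν, Measure.map_map (measurable_incrShift v) measurable_incrementMap]
    have : incrShift v ∘ incrementMap (d := d) = incrementMap ∘ pathShift v := rfl
    rw [this, ← Measure.map_map measurable_incrementMap (measurable_pathShift v), (hall v).map_eq]
  obtain ⟨c, hc⟩ := exists_eq_smul_of_ergodic hQ
    (map_incrementMap_absolutelyContinuous (withDensity_absolutelyContinuous _ ρ)) hνinv
  have hcu : m Set.univ = c := by
    have h1 : ν Set.univ = m Set.univ := by
      rw [hν, Measure.map_apply measurable_incrementMap MeasurableSet.univ, Set.preimage_univ]
    rw [← h1, hν, hc]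
    simp
  have hc0 : c ≠ 0 := by
    rw [← hcu]
    simpa using hm0
  have hct : c ≠ ⊤ := by
    rw [← hcu]
    exact measure_ne_top m _
  refine ⟨c⁻¹ • m, ⟨⟨?_⟩, fun v => (hall v).smul_measure _⟩, measurable_incrementMap, ?_⟩
  · rw [Measure.smul_apply, hcu, smul_eq_mul, ENNReal.inv_mul_cancel hc0 hct]
  · rw [Measure.map_smul, hc, smul_smul, ENNReal.inv_mul_cancel hc0 hct, one_smul]

end PathMeasure

/-! ### Vanishing return probabilities or a stationary version -/

section Dichotomy

variable {d : ℕ} {Q : Measure (IncrementSpace d)}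

/-- The mean of the return probabilities, weighted by `e^{-εt}`. -/
noncomputable def returnMean (Q : Measure (IncrementSpace d)) (R ε : ℝ) : ℝ≥0∞ :=
  ENNReal.ofReal ε * ∫⁻ t in Set.Ioi (0 : ℝ),
    ENNReal.ofReal (Real.exp (-ε * t)) * Q {ω | ‖incr 0 t ω‖ ≤ R}

/-- A path that starts in the unit ball and has displacement at most `R` over `[0, t]` is within `R
+ 1` of the origin at both times. -/
theorem pathMeasure_inter_ge (R t : ℝ) :
    Q {ω | ‖incr 0 t ω‖ ≤ R} * volume (Metric.closedBall (0 : EuclideanSpace ℝ (Fin d)) 1) ≤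
      pathMeasure Q ({γ | ‖γ 0‖ ≤ R + 1} ∩ pathShift t ⁻¹' {γ | ‖γ 0‖ ≤ R + 1}) := by
  rcases lt_or_ge R 0 with hR | hR
  · have : {ω : IncrementSpace d | ‖incr 0 t ω‖ ≤ R} = ∅ := by
      ext ω
      simp only [Set.mem_ofPred_eq, Set.mem_empty_iff_false, iff_false, not_le]
      exact hR.trans_le (norm_nonneg _)
    simp [this]
  have hm : MeasurableSet {γ : PathSpace d | ‖γ 0‖ ≤ R + 1} :=
    measurableSet_le (measurable_eval 0).norm measurable_const
  rw [pathMeasure, Measure.map_apply measurable_pathOf (hm.inter (measurable_pathShift t hm)),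
    ← Measure.prod_prod]
  refine measure_mono ?_
  rintro ⟨ω, x⟩ ⟨h1, h2⟩
  simp only [Set.mem_ofPred_eq, Metric.mem_closedBall, dist_zero_right] at h1 h2
  refine ⟨?_, ?_⟩
  · change ‖x + incr 0 0 ω‖ ≤ R + 1
    rw [incr_self, add_zero]
    linarith
  · change ‖x + incr 0 (0 + t) ω‖ ≤ R + 1
    rw [zero_add]
    exact (norm_add_le _ _).trans (by linarith)

variable [IsProbabilityMeasure Q]

/-- The Koopman isometries of the time shifts. -/
noncomputable def koopman (hQ : Q ∈ stationaryIncrementLaws d) (t : ℝ) :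
    Lp ℝ 2 (pathMeasure Q) →ₗᵢ[ℝ] Lp ℝ 2 (pathMeasure Q) :=
  Lp.compMeasurePreservingₗᵢ ℝ (pathShift t) (measurePreserving_pathShift hQ t)

theorem koopman_apply (hQ : Q ∈ stationaryIncrementLaws d) (t : ℝ) (h : Lp ℝ 2 (pathMeasure Q)) :
    koopman hQ t h =
      Lp.compMeasurePreserving (pathShift t) (measurePreserving_pathShift hQ t) h := rfl

theorem coeFn_koopman (hQ : Q ∈ stationaryIncrementLaws d) (t : ℝ)
    (h : Lp ℝ 2 (pathMeasure Q)) :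
    koopman hQ t h =ᵐ[pathMeasure Q] fun γ => h (pathShift t γ) :=
  Lp.coeFn_compMeasurePreserving h (measurePreserving_pathShift hQ t)

theorem koopman_koopman (hQ : Q ∈ stationaryIncrementLaws d) (s t : ℝ)
    (h : Lp ℝ 2 (pathMeasure Q)) : koopman hQ t (koopman hQ s h) = koopman hQ (t + s) h := by
  refine Lp.ext ?_
  filter_upwards [coeFn_koopman hQ t (koopman hQ s h), coeFn_koopman hQ (t + s) h,
    (measurePreserving_pathShift hQ t).quasiMeasurePreserving.ae (coeFn_koopman hQ s h)]
    with γ h1 h2 h3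
  rw [h1, h2, h3, pathShift_pathShift]

theorem continuous_koopman (hQ : Q ∈ stationaryIncrementLaws d) (h : Lp ℝ 2 (pathMeasure Q)) :
    Continuous fun t => koopman hQ t h := by
  set τ : C(ℝ, C(PathSpace d, PathSpace d)) :=
    ContinuousMap.curry ⟨fun p : ℝ × PathSpace d => pathShift p.1 p.2, continuous_pathShift_uncurry⟩
    with hτ
  exact Continuous.compMeasurePreservingLp (f := fun _ : ℝ => h) (g := τ) continuous_const
    τ.continuous (fun t => measurePreserving_pathShift hQ t) (by norm_num)

/-- Either the weighted return probabilities tend to zero, or there is a stationary version. -/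
theorem tendsto_returnMean_of_not_stationary (hQ : Q ∈ ergodicIncrementLaws d)
    (hnot : ¬ ∃ Q' ∈ stationaryLaws d, MeasurePreserving incrementMap Q' Q) (R : ℝ) :
    Tendsto (returnMean Q R) (𝓝[>] 0) (𝓝 0) := by
  set S : Set (PathSpace d) := {γ | ‖γ 0‖ ≤ R + 1} with hS
  have hSm : MeasurableSet S := measurableSet_le (measurable_eval 0).norm measurable_const
  have hSfin : pathMeasure Q S ≠ ⊤ := (pathMeasure_norm_eval_zero_le_lt_top (R + 1)).ne
  -- Although `pathMeasure Q` is infinite, `S` has finite measure, so its indicator lies in `L²`.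
  set g : Lp ℝ 2 (pathMeasure Q) := indicatorConstLp 2 hSm hSfin (1 : ℝ) with hg
  have hinner : ∀ t, inner ℝ g (koopman hQ.1 t g) =
      (pathMeasure Q).real (S ∩ pathShift t ⁻¹' S) := by
    intro t
    rw [koopman_apply, hg, Lp.indicatorConstLp_compMeasurePreserving]
    exact L2.real_inner_indicatorConstLp_one_indicatorConstLp_one hSm (measurable_pathShift t hSm)
      hSfin _
  have hlim := tendsto_abel_mean_inner (koopman hQ.1) (koopman_koopman hQ.1)
    (continuous_koopman hQ.1) g fun ψ hψ => by
      by_contra hne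
      refine hnot (exists_stationary_of_invariant hQ (Lp.stronglyMeasurable ψ).measurable
        (Lp.memLp ψ) (fun h0 => hne ?_) fun s hs => ?_)
      · have : ψ = 0 := (Lp.eq_zero_iff_ae_eq_zero).2 h0
        rw [this, inner_zero_left]
      · have h1 := coeFn_koopman hQ.1 s ψ
        rw [hψ s hs] at h1
        exact h1.symm
  simp_rw [hinner] at hlim
  set b : ℝ≥0∞ := volume (Metric.closedBall (0 : EuclideanSpace ℝ (Fin d)) 1) with hb
  have hb0 : b ≠ 0 := (Metric.measure_closedBall_pos volume _ one_pos).ne'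
  have hbt : b ≠ ⊤ := measure_closedBall_lt_top.ne
  have hcorr : Continuous fun t => (pathMeasure Q).real (S ∩ pathShift t ⁻¹' S) := by
    simp_rw [← hinner]
    exact continuous_const.inner (continuous_koopman hQ.1 g)
  have hcorrB : ∀ t, |(pathMeasure Q).real (S ∩ pathShift t ⁻¹' S)| ≤ (pathMeasure Q).real S :=
    fun t => by
      rw [abs_of_nonneg measureReal_nonneg]
      exact measureReal_mono Set.inter_subset_left hSfin
  have hle : ∀ ε ∈ Set.Ioi (0 : ℝ), returnMean Q R ε ≤ ENNReal.ofReal (ε *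
      ∫ t in Set.Ioi (0 : ℝ), Real.exp (-ε * t) * (pathMeasure Q).real (S ∩ pathShift t ⁻¹' S)) *
        b⁻¹ := by
    intro ε hε
    rw [ENNReal.ofReal_mul (le_of_lt hε), returnMean, mul_assoc]
    gcongr
    rw [ofReal_integral_eq_lintegral_ofReal (integrableOn_exp_mul_of_bound hcorr hcorrB hε 0)
      (ae_of_all _ fun t => mul_nonneg (Real.exp_pos _).le measureReal_nonneg),
      ← lintegral_mul_const' _ _ (ENNReal.inv_ne_top.2 hb0)]
    refine lintegral_mono fun t => ?_
    rw [ENNReal.ofReal_mul (Real.exp_pos _).le, mul_assoc, ofReal_measureReal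
      (ne_top_of_le_ne_top hSfin (measure_mono Set.inter_subset_left))]
    gcongr
    rw [← div_eq_mul_inv, ENNReal.le_div_iff_mul_le (Or.inl hb0) (Or.inl hbt)]
    exact pathMeasure_inter_ge R t
  have hlim2 := ENNReal.Tendsto.mul_const (ENNReal.tendsto_ofReal hlim)
    (Or.inr (ENNReal.inv_ne_top.2 hb0))
  rw [ENNReal.ofReal_zero, zero_mul] at hlim2
  refine tendsto_of_tendsto_of_tendsto_of_le_of_le' tendsto_const_nhds hlim2
    (Eventually.of_forall fun _ => zero_le) ?_
  filter_upwards [self_mem_nhdsWithin] with ε hε using hle ε hε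

end Dichotomy

/-! ### From return probabilities to the Coulomb potential -/

section Coulomb

variable {d : ℕ}

/-- Prepares monotone convergence from the smoothed potentials, on which all estimates are uniform;
at `x = 0` both sides are infinite. -/
theorem enorm_inv_eq_iSup (x : EuclideanSpace ℝ (Fin d)) :
    ‖x‖ₑ⁻¹ = ⨆ k : ℕ, ENNReal.ofReal (‖x‖ + 1 / ((k : ℝ) + 1))⁻¹ := by
  symm
  have hpos : ∀ k : ℕ, 0 < ‖x‖ + 1 / ((k : ℝ) + 1) := fun k => by positivity
  refine iSup_eq_of_tendsto (fun k l hkl => ?_) ?_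
  · have : (k : ℝ) ≤ l := by exact_mod_cast hkl
    have := hpos l
    gcongr
  · simp_rw [ENNReal.ofReal_inv_of_pos (hpos _)]
    have h1 : Tendsto (fun k : ℕ => ‖x‖ + 1 / ((k : ℝ) + 1)) atTop (𝓝 (‖x‖ + 0)) :=
      tendsto_const_nhds.add tendsto_one_div_add_atTop_nhds_zero_nat
    rw [add_zero] at h1
    have h2 := (ENNReal.tendsto_ofReal h1).inv
    rwa [ofReal_norm] at h2

/-- One term for each range: far away (`‖x‖ > R`), intermediate (`‖x‖ ≤ R` and `‖x‖ + δ ≥ η`), and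
near the singularity (`‖x‖ + δ ≤ η`), where a factor `√η` is gained from the stronger potential. -/
theorem inv_norm_add_le {R η δ : ℝ} (hR : 0 < R) (hη : 0 < η) (hδ : 0 < δ)
    (x : EuclideanSpace ℝ (Fin d)) :
    (‖x‖ + δ)⁻¹ ≤ R⁻¹ + η⁻¹ * (if ‖x‖ ≤ R then 1 else 0) + √η * softPotential δ x := by
  have hy : 0 < ‖x‖ + δ := by positivity
  have hs := softPotential_nonneg hδ x
  have hsq : 0 ≤ √η * softPotential δ x := by positivity
  split_ifs with hx
  · rcases le_total (‖x‖ + δ) η with h | h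
    · have h1 : (‖x‖ + δ)⁻¹ ≤ √η * softPotential δ x := by
        unfold softPotential
        have hsy : 0 < √(‖x‖ + δ) := Real.sqrt_pos.2 hy
        have h2 : √(‖x‖ + δ) ≤ √η := Real.sqrt_le_sqrt h
        rw [mul_inv, mul_left_comm]
        have h3 : 1 ≤ √η * (√(‖x‖ + δ))⁻¹ := by
          rw [← div_eq_mul_inv, one_le_div hsy]
          exact h2
        exact le_mul_of_one_le_right (by positivity) h3
      have : 0 ≤ R⁻¹ + η⁻¹ * 1 := by positivity
      linarith
    · have h1 : (‖x‖ + δ)⁻¹ ≤ η⁻¹ := by gcongr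
      have : 0 ≤ R⁻¹ := by positivity
      linarith
  · push Not at hx
    have h1 : (‖x‖ + δ)⁻¹ ≤ R⁻¹ := by
      gcongr
      linarith
    linarith

theorem lintegral_exp_Ioi {ε : ℝ} (hε : 0 < ε) :
    ENNReal.ofReal ε * ∫⁻ t in Set.Ioi (0 : ℝ), ENNReal.ofReal (Real.exp (-ε * t)) = 1 := by
  rw [← ofReal_integral_eq_lintegral_ofReal (integrableOn_exp_mul_Ioi (by linarith) 0)
    (ae_of_all _ fun t => (Real.exp_pos _).le), integral_Ioi_exp_neg_mul hε,
    ← ENNReal.ofReal_mul hε.le, mul_inv_cancel₀ hε.ne', ENNReal.ofReal_one]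

theorem ofReal_mul_tsum_exp_le {ε : ℝ} (hε : 0 < ε) (hε1 : ε ≤ 1) :
    ENNReal.ofReal ε * ∑' n : ℕ, ENNReal.ofReal (Real.exp (-ε * n)) ≤ 2 := by
  have h1 : ∀ n : ℕ, ENNReal.ofReal (Real.exp (-ε * n)) = ENNReal.ofReal (Real.exp (-ε)) ^ n :=
    fun n => by
      rw [← ENNReal.ofReal_pow (Real.exp_pos _).le, ← Real.exp_nat_mul]
      ring_nf
  have hq : Real.exp (-ε) ≤ (1 + ε)⁻¹ := by
    rw [Real.exp_neg]
    gcongr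
    linarith [Real.add_one_le_exp ε]
  -- This bounds the geometric series by `2 / ε`; the inequality `(1 + ε)⁻¹ ≤ 1 - ε / 2` is where `ε
  -- ≤ 1` is needed.
  have hq' : ε / 2 ≤ 1 - Real.exp (-ε) := by
    have : (1 + ε)⁻¹ ≤ 1 - ε / 2 := by
      rw [inv_le_iff_one_le_mul₀ (by linarith)]
      nlinarith
    linarith
  simp_rw [h1]
  rw [ENNReal.tsum_geometric, ← ENNReal.ofReal_one, ← ENNReal.ofReal_sub _ (Real.exp_pos _).le,
    ← div_eq_mul_inv]
  refine ENNReal.div_le_of_le_mul ?_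
  rw [← ENNReal.ofReal_ofNat 2, ← ENNReal.ofReal_mul (by norm_num)]
  exact ENNReal.ofReal_le_ofReal (by linarith)

/-- The weighted mean of a function of the increments over `[0, t]`. -/
noncomputable def abelIntegral (Q : Measure (IncrementSpace d)) (ε : ℝ)
    (f : EuclideanSpace ℝ (Fin d) → ℝ≥0∞) : ℝ≥0∞ :=
  ∫⁻ ω, (∫⁻ t in Set.Ioi (0 : ℝ), ENNReal.ofReal (Real.exp (-ε * t)) * f (incr 0 t ω)) ∂Q

theorem measurable_exp_mul_comp_incr (ε : ℝ) {f : EuclideanSpace ℝ (Fin d) → ℝ≥0∞}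
    (hf : Measurable f) : Measurable fun p : IncrementSpace d × ℝ =>
      ENNReal.ofReal (Real.exp (-ε * p.2)) * f (incr 0 p.2 p.1) := by
  have h : Measurable fun p : IncrementSpace d × ℝ => incr 0 p.2 p.1 :=
    (Continuous.incr continuous_const continuous_snd continuous_fst).measurable
  exact Measurable.mul (by fun_prop) (hf.comp h)

variable {Q : Measure (IncrementSpace d)}

theorem abelIntegral_mono (ε : ℝ) {f g : EuclideanSpace ℝ (Fin d) → ℝ≥0∞} (h : ∀ x, f x ≤ g x) :
    abelIntegral Q ε f ≤ abelIntegral Q ε g :=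
  lintegral_mono fun ω => lintegral_mono fun t => by
    gcongr
    exact h _

theorem abelIntegral_add (ε : ℝ) {f g : EuclideanSpace ℝ (Fin d) → ℝ≥0∞} (hf : Measurable f) :
    abelIntegral Q ε (fun x => f x + g x) = abelIntegral Q ε f + abelIntegral Q ε g := by
  have hm := measurable_exp_mul_comp_incr (d := d) ε hf
  unfold abelIntegral
  rw [← lintegral_add_left hm.lintegral_prod_right']
  refine lintegral_congr fun ω => ?_
  simp_rw [mul_add]
  exact lintegral_add_left (hm.comp measurable_prodMk_left) _

theorem abelIntegral_const_mul (ε : ℝ) {c : ℝ≥0∞} (hc : c ≠ ⊤)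
    (f : EuclideanSpace ℝ (Fin d) → ℝ≥0∞) :
    abelIntegral Q ε (fun x => c * f x) = c * abelIntegral Q ε f := by
  unfold abelIntegral
  rw [← lintegral_const_mul' _ _ hc]
  refine lintegral_congr fun ω => ?_
  rw [← lintegral_const_mul' _ _ hc]
  simp_rw [mul_left_comm]

theorem abelIntegral_iSup (ε : ℝ) {f : ℕ → EuclideanSpace ℝ (Fin d) → ℝ≥0∞}
    (hf : ∀ k, Measurable (f k)) (hmono : ∀ x, Monotone fun k => f k x) :
    abelIntegral Q ε (fun x => ⨆ k, f k x) = ⨆ k, abelIntegral Q ε (f k) := by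
  unfold abelIntegral
  have hm := fun k => measurable_exp_mul_comp_incr (d := d) ε (hf k)
  rw [← lintegral_iSup fun k => (hm k).lintegral_prod_right']
  · refine lintegral_congr fun ω => ?_
    simp_rw [ENNReal.mul_iSup]
    refine lintegral_iSup (fun k => (hm k).comp measurable_prodMk_left) fun k l hkl t => ?_
    dsimp only [Function.comp]
    gcongr
    exact hmono _ hkl
  · intro k l hkl ω
    refine lintegral_mono fun t => ?_
    dsimp only
    gcongr
    exact hmono _ hkl

theorem abelIntegral_indicator [IsProbabilityMeasure Q] (R ε : ℝ) :
    ENNReal.ofReal ε * abelIntegral Q ε (fun x => ENNReal.ofReal (if ‖x‖ ≤ R then 1 else 0)) =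
      returnMean Q R ε := by
  have hset : MeasurableSet {x : EuclideanSpace ℝ (Fin d) | ‖x‖ ≤ R} :=
    measurableSet_le measurable_norm measurable_const
  have hf : Measurable fun x : EuclideanSpace ℝ (Fin d) =>
      ENNReal.ofReal (if ‖x‖ ≤ R then 1 else 0) :=
    (Measurable.ite hset measurable_const measurable_const).ennreal_ofReal
  unfold abelIntegral returnMean
  rw [lintegral_lintegral_swap (measurable_exp_mul_comp_incr ε hf).aemeasurable]
  congr 1
  refine lintegral_congr fun t => ?_
  rw [lintegral_const_mul' _ _ ENNReal.ofReal_ne_top]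
  congr 1
  refine Eq.trans ?_ (lintegral_indicator_one ((measurable_incr 0 t) hset))
  refine lintegral_congr fun ω => ?_
  by_cases h : ‖incr 0 t ω‖ ≤ R <;> simp [Set.indicator, h]

theorem abelIntegral_one [IsProbabilityMeasure Q] {ε : ℝ} (hε : 0 < ε) :
    ENNReal.ofReal ε * abelIntegral Q ε (fun _ => 1) = 1 := by
  unfold abelIntegral
  simpa using lintegral_exp_Ioi hε

/-- On `(n, n + 1]` the weight is at most `exp (-ε n)`, and these values sum to at most `2 / ε`. -/
theorem abelIntegral_le_of_unit_intervals {f : EuclideanSpace ℝ (Fin d) → ℝ≥0∞}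
    (hf : Measurable f) {K : ℝ≥0∞}
    (hK : ∀ n : ℕ, ∫⁻ ω, (∫⁻ t in Set.Ioc (n : ℝ) (n + 1), f (incr 0 t ω)) ∂Q ≤ K)
    {ε : ℝ} (hε : 0 < ε) (hε1 : ε ≤ 1) :
    ENNReal.ofReal ε * abelIntegral Q ε f ≤ 2 * K := by
  have hm : Measurable fun p : IncrementSpace d × ℝ => f (incr 0 p.2 p.1) := by
    simpa using measurable_exp_mul_comp_incr 0 hf
  have hcover : Set.Ioi (0 : ℝ) ⊆ ⋃ n : ℕ, Set.Ioc (n : ℝ) (n + 1) := by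
    intro t ht
    have ht' : (0 : ℝ) < t := ht
    have hc : 0 < ⌈t⌉₊ := Nat.ceil_pos.2 ht'
    refine Set.mem_iUnion.2 ⟨⌈t⌉₊ - 1, ?_, ?_⟩
    · exact Nat.lt_ceil.1 (by omega)
    · have := Nat.le_ceil t
      rw [Nat.cast_sub hc]
      simpa using this
  have h1 : abelIntegral Q ε f ≤
      ∑' n : ℕ, ENNReal.ofReal (Real.exp (-ε * n)) * K := by
    calc abelIntegral Q ε f ≤ ∫⁻ ω, (∑' n : ℕ, ENNReal.ofReal (Real.exp (-ε * n)) *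
            ∫⁻ t in Set.Ioc (n : ℝ) (n + 1), f (incr 0 t ω)) ∂Q := by
          refine lintegral_mono fun ω => ?_
          refine (lintegral_mono_set hcover).trans ((lintegral_iUnion_le _ _).trans ?_)
          refine ENNReal.tsum_le_tsum fun n => ?_
          rw [← lintegral_const_mul' _ _ ENNReal.ofReal_ne_top]
          refine setLIntegral_mono' measurableSet_Ioc fun t ht => ?_
          gcongr ENNReal.ofReal (Real.exp ?_) * _
          nlinarith [ht.1]
      _ = ∑' n : ℕ, ∫⁻ ω, ENNReal.ofReal (Real.exp (-ε * n)) *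
            (∫⁻ t in Set.Ioc (n : ℝ) (n + 1), f (incr 0 t ω)) ∂Q :=
          lintegral_tsum fun n => (hm.lintegral_prod_right'.const_mul _).aemeasurable
      _ ≤ _ := by
          refine ENNReal.tsum_le_tsum fun n => ?_
          rw [lintegral_const_mul' _ _ ENNReal.ofReal_ne_top]
          gcongr
          exact hK n
  calc _ ≤ ENNReal.ofReal ε * ∑' n : ℕ, ENNReal.ofReal (Real.exp (-ε * n)) * K := by gcongr
    _ = (ENNReal.ofReal ε * ∑' n : ℕ, ENNReal.ofReal (Real.exp (-ε * n))) * K := by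
        rw [ENNReal.tsum_mul_right, mul_assoc]
    _ ≤ _ := by
        gcongr
        exact ofReal_mul_tsum_exp_le hε hε1

theorem mul_coulombIntegral_le [IsProbabilityMeasure Q] {K : ℝ≥0∞}
    (hK : ∀ δ : ℝ, 0 < δ → ∀ n : ℕ, ∫⁻ ω, (∫⁻ t in Set.Ioc (n : ℝ) (n + 1),
      ENNReal.ofReal (softPotential δ (incr 0 t ω))) ∂Q ≤ K)
    {R η ε : ℝ} (hR : 0 < R) (hη : 0 < η) (hε : 0 < ε) (hε1 : ε ≤ 1) :
    ENNReal.ofReal ε * coulombIntegral Q ε ≤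
      ENNReal.ofReal R⁻¹ + ENNReal.ofReal η⁻¹ * returnMean Q R ε + ENNReal.ofReal √η * (2 * K) := by
  have hcm : ∀ δ : ℝ, 0 < δ → Measurable fun x : EuclideanSpace ℝ (Fin d) =>
      ENNReal.ofReal (‖x‖ + δ)⁻¹ := fun δ _ => by fun_prop
  have h1 : coulombIntegral Q ε = ⨆ k : ℕ, abelIntegral Q ε
      (fun x => ENNReal.ofReal (‖x‖ + 1 / ((k : ℝ) + 1))⁻¹) := by
    rw [← abelIntegral_iSup ε fun k => hcm _ (by positivity)]
    · simp_rw [← enorm_inv_eq_iSup]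
      rfl
    · intro x k l hkl
      have : (k : ℝ) ≤ l := by exact_mod_cast hkl
      have hpos : 0 < ‖x‖ + 1 / ((l : ℝ) + 1) := by positivity
      dsimp only
      gcongr
  rw [h1, ENNReal.mul_iSup]
  refine iSup_le fun k => ?_
  set δ : ℝ := 1 / ((k : ℝ) + 1) with hδdef
  have hδ : 0 < δ := by positivity
  have hset : MeasurableSet {x : EuclideanSpace ℝ (Fin d) | ‖x‖ ≤ R} :=
    measurableSet_le measurable_norm measurable_const
  have hind : Measurable fun x : EuclideanSpace ℝ (Fin d) =>
      ENNReal.ofReal η⁻¹ * ENNReal.ofReal (if ‖x‖ ≤ R then 1 else 0) :=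
    (Measurable.ite hset measurable_const measurable_const).ennreal_ofReal.const_mul _
  have h2 : ∀ x : EuclideanSpace ℝ (Fin d), ENNReal.ofReal (‖x‖ + δ)⁻¹ ≤
      ENNReal.ofReal R⁻¹ * 1 + ENNReal.ofReal η⁻¹ * ENNReal.ofReal (if ‖x‖ ≤ R then 1 else 0) +
        ENNReal.ofReal √η * ENNReal.ofReal (softPotential δ x) := by
    intro x
    rw [← ENNReal.ofReal_mul (by positivity), ← ENNReal.ofReal_mul (by positivity), mul_one]
    refine (ENNReal.ofReal_le_ofReal (inv_norm_add_le hR hη hδ x)).trans ?_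
    refine ENNReal.ofReal_add_le.trans ?_
    gcongr
    exact ENNReal.ofReal_add_le
  calc _ ≤ ENNReal.ofReal ε * abelIntegral Q ε (fun x =>
        ENNReal.ofReal R⁻¹ * 1 + ENNReal.ofReal η⁻¹ * ENNReal.ofReal (if ‖x‖ ≤ R then 1 else 0) +
        ENNReal.ofReal √η * ENNReal.ofReal (softPotential δ x)) := by
        gcongr
        exact abelIntegral_mono ε h2
    _ = ENNReal.ofReal R⁻¹ * (ENNReal.ofReal ε * abelIntegral Q ε (fun _ => 1)) +
        ENNReal.ofReal η⁻¹ * (ENNReal.ofReal ε * abelIntegral Q ε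
          (fun x => ENNReal.ofReal (if ‖x‖ ≤ R then 1 else 0))) +
        ENNReal.ofReal √η * (ENNReal.ofReal ε * abelIntegral Q ε
          (fun x => ENNReal.ofReal (softPotential δ x))) := by
        have hind' : Measurable fun x : EuclideanSpace ℝ (Fin d) => ENNReal.ofReal R⁻¹ * 1 +
            ENNReal.ofReal η⁻¹ * ENNReal.ofReal (if ‖x‖ ≤ R then 1 else 0) :=
          measurable_const.add hind
        rw [abelIntegral_add ε hind', abelIntegral_add ε measurable_const,
          abelIntegral_const_mul ε ENNReal.ofReal_ne_top,
          abelIntegral_const_mul ε ENNReal.ofReal_ne_top,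
          abelIntegral_const_mul ε ENNReal.ofReal_ne_top]
        ring
    _ ≤ _ := by
        rw [abelIntegral_one hε, mul_one, abelIntegral_indicator]
        exact add_le_add le_rfl (mul_le_mul' le_rfl (abelIntegral_le_of_unit_intervals
          (continuous_softPotential hδ).measurable.ennreal_ofReal (hK δ hδ) hε hε1))

theorem tendsto_mul_coulombIntegral [IsProbabilityMeasure Q] {K : ℝ≥0∞} (hKtop : K ≠ ⊤)
    (hK : ∀ δ : ℝ, 0 < δ → ∀ n : ℕ, ∫⁻ ω, (∫⁻ t in Set.Ioc (n : ℝ) (n + 1),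
      ENNReal.ofReal (softPotential δ (incr 0 t ω))) ∂Q ≤ K)
    (hret : ∀ R, Tendsto (returnMean Q R) (𝓝[>] 0) (𝓝 0)) :
    Tendsto (fun ε : ℝ => ENNReal.ofReal ε * coulombIntegral Q ε) (𝓝[>] 0) (𝓝 0) := by
  rw [ENNReal.tendsto_nhds_zero]
  intro κ hκ
  have hκ3 : 0 < κ / 3 := ENNReal.div_pos hκ.ne' (by norm_num)
  -- `R` and `η` are fixed first, making the far and near terms small uniformly in `ε`; only then
  -- does `ε` tend to zero, which removes the return term despite its factor `η⁻¹`.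
  obtain ⟨R, hRκ, hR⟩ : ∃ R : ℝ, ENNReal.ofReal R⁻¹ ≤ κ / 3 ∧ 0 < R := by
    have h := ENNReal.tendsto_ofReal (tendsto_inv_atTop_zero (𝕜 := ℝ))
    rw [ENNReal.ofReal_zero] at h
    exact ((ENNReal.tendsto_nhds_zero.1 h _ hκ3).and (eventually_gt_atTop 0)).exists
  obtain ⟨η, hηκ, hη⟩ : ∃ η : ℝ, ENNReal.ofReal √η * (2 * K) ≤ κ / 3 ∧ 0 < η := by
    have h0 : Tendsto (fun η : ℝ => √η) (𝓝[>] 0) (𝓝 0) := by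
      have := Real.continuous_sqrt.tendsto 0
      rw [Real.sqrt_zero] at this
      exact this.mono_left nhdsWithin_le_nhds
    have h := ENNReal.Tendsto.mul_const (b := 2 * K) (ENNReal.tendsto_ofReal h0)
      (Or.inr (ENNReal.mul_ne_top (by norm_num) hKtop))
    rw [ENNReal.ofReal_zero, zero_mul] at h
    exact ((ENNReal.tendsto_nhds_zero.1 h _ hκ3).and self_mem_nhdsWithin).exists
  have hret' := ENNReal.Tendsto.const_mul (a := ENNReal.ofReal η⁻¹) (hret R)
    (Or.inr ENNReal.ofReal_ne_top)
  rw [mul_zero] at hret'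
  filter_upwards [ENNReal.tendsto_nhds_zero.1 hret' _ hκ3, Ioo_mem_nhdsGT (zero_lt_one (α := ℝ))]
    with ε h1 hε
  calc _ ≤ _ := mul_coulombIntegral_le hK hR hη hε.1 hε.2.le
    _ ≤ κ / 3 + κ / 3 + κ / 3 := by gcongr
    _ = κ := ENNReal.add_thirds κ

end Coulomb

end IncrementProcess

theorem corollary3p3
    (P : MeasureTheory.Measure (IncrementProcess.IncrementSpace 3))
    (hP : IncrementProcess.IsBrownianIncrementLaw P)
    (Q : MeasureTheory.Measure (IncrementProcess.IncrementSpace 3))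
    [MeasureTheory.IsProbabilityMeasure Q]
    (hQ : Q ∈ IncrementProcess.ergodicIncrementLaws 3)
    (hH : IncrementProcess.specificEntropy Q P < ⊤) :
    Tendsto (fun ε : ℝ => ENNReal.ofReal ε * IncrementProcess.coulombIntegral Q ε) (𝓝[>] 0) (𝓝 0) ∨
      ∃ Q' ∈ IncrementProcess.stationaryLaws 3,
        MeasureTheory.MeasurePreserving IncrementProcess.incrementMap Q' Q := by
  have hst := hQ.1
  by_cases hnot : ∃ Q' ∈ IncrementProcess.stationaryLaws 3,
      MeasureTheory.MeasurePreserving IncrementProcess.incrementMap Q' Q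
  · exact Or.inr hnot
  · refine Or.inl (IncrementProcess.tendsto_mul_coulombIntegral
      (K := 1000 * (IncrementProcess.specificEntropy Q P + ENNReal.ofReal (Real.log 2)))
      (ENNReal.mul_ne_top (by norm_num) (ENNReal.add_ne_top.2 ⟨hH.ne, ENNReal.ofReal_ne_top⟩))
      (fun δ hδ n => IncrementProcess.lintegral_softPotential_le hP hst hδ n)
      (IncrementProcess.tendsto_returnMean_of_not_stationary hQ hnot))
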